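/- Let $\mu\in H^3((0,1),\mathbb{R})$. Write $\langle f,g\rangle=\int_0^1 f\,\overline{g}\,dx$, $\lambda_k=(k\pi)^2$, $\varphi_k(x)=\sqrt2\,\sin(k\pi x)$, $\Phi_k(t)=e^{-i\lambda_k t}\varphi_k$ for $k\ge 1$, and $A=-\partial_{xx}^2$ with domain $H^2\cap H^1_0((0,1),\mathbb{C})$. For $T>0$ and $u\in L^2((0,T),\mathbb{R})$, the solution of $$i\partial_t\psi=-\partial_{xx}^2\psi-u(t)\mu(x)\psi\ \text{ on }(0,T)\times(0,1),\qquad \psi(t,0)=\psi(t,1)=0,\qquad \psi(0)=\psi_0,$$ is understood in the weak sense: $\psi\in C^0([0,T],H^3_{(0)})$ with $H^3_{(0)}=\mathcal{D}(A^{3/2})$, and $\psi(t)=e^{-iAt}\psi_0+i\int_0^t e^{-iA(t-\tau)}u(\tau)\mu\psi(\tau)\,d\tau$ for all $t\in[0,T]$. Put $m_k=\langle\mu\varphi_k,\varphi_k\rangle$, $d_k=\langle(\mu')^2\varphi_k,\varphi_k\rangle$ and $$\mathcal{B}_{j,k,l}=(m_l-m_k)\,d_j+(m_j-m_l)\,d_k+(m_k-m_j)\,d_l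 .$$ Assume that $\mathcal{B}:=\mathcal{B}_{1,2,3}\neq0$. Let $(j,k,l)$ be a permutation of $(1,2,3)$ with $m_j\neq m_k$; such a permutation exists because $\mathcal{B}\ne0$, and $(j,k,l)=(1,2,3)$ is allowed if $m_1\neq m_2$. Let $\beta=\operatorname{sign}\big(\mathcal{B}_{j,k,l}\,(m_k-m_j)\big)\in\{-1,1\}$. Then there exist $T_*>0$ and $\varepsilon>0$ such that, for every $T\in(0,T_*)$ and every $u\in L^2((0,T),\mathbb{R})$ with $\|u\|_{L^2(0,T)}<\varepsilon$, the solutions $\psi^j,\psi^k,\psi^l$ with initial data $\varphi_j,\varphi_k,\varphi_l$ and the common control $u$ satisfy, for every $\delta>0$ and every $\nu\in\mathbb{R}$, $$\big(\psi^j(T),\psi^k(T),\psi^l(T)\big)\neq e^{i\nu}\Big(\Phi_j(T),\ \Phi_k(T),\ \big(\sqrt{1-\delta^2}+i\beta\delta\big)\Phi_l(T)\Big),$$ where $\sqrt{1-\delta^2}$ is read as $0$ if $\delta>1$. -/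

import Mathlib

open MeasureTheory Set Filter Topology
open scoped ContDiff ENNReal InnerProductSpace

noncomputable section

namespace BilinearSchrodinger

/-! ### Sobolev regularity on the interval `(0,1)` -/

/-- Lebesgue measure on the open interval `(0,1)`. -/
def vol01 : Measure ℝ := volume.restrict (Ioo (0 : ℝ) 1)

/-- `g` is a weak derivative of order `m` of `f` on `(0,1)`. -/
def HasWeakDeriv (m : ℕ) (f g : ℝ → ℝ) : Prop :=
  LocallyIntegrableOn f (Ioo (0 : ℝ) 1) ∧ LocallyIntegrableOn g (Ioo (0 : ℝ) 1) ∧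
  ∀ χ : ℝ → ℝ, ContDiff ℝ ∞ χ → HasCompactSupport χ → tsupport χ ⊆ Ioo (0 : ℝ) 1 →
    ∫ x in Ioo (0 : ℝ) 1, f x * iteratedDeriv m χ x
      = (-1 : ℝ) ^ m * ∫ x in Ioo (0 : ℝ) 1, g x * χ x

/-- `f` belongs to the Sobolev space `H^m((0,1), ℝ)`. -/
def MemSobolev (m : ℕ) (f : ℝ → ℝ) : Prop :=
  MemLp f 2 vol01 ∧
  ∀ n : ℕ, 1 ≤ n → n ≤ m → ∃ g : ℝ → ℝ, MemLp g 2 vol01 ∧ HasWeakDeriv n f g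

open Classical in
/-- The weak derivative `f'` of `f` on `(0,1)`, which is unique up to a null set
(and `0` when `f` has no weak derivative). -/
def weakDeriv (f : ℝ → ℝ) : ℝ → ℝ :=
  if h : ∃ g : ℝ → ℝ, HasWeakDeriv 1 f g then h.choose else 0

/-! ### The Dirichlet Laplacian `A` on `(0,1)` -/

/-- The eigenvalue `λ_k = (kπ)²`. -/
def eigenvalue (k : ℕ) : ℝ := (k * Real.pi) ^ 2

/-- The real function `φ_k(x) = √2 sin(kπx)`. -/
def sineFun (k : ℕ) (x : ℝ) : ℝ := Real.sqrt 2 * Real.sin (k * Real.pi * x)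

/-- The space `L²((0,1), ℂ)`. -/
abbrev StateSpace : Type := Lp ℂ 2 vol01

instance : IsFiniteMeasure vol01 := by
  unfold vol01; infer_instance

theorem memLp_sineFun (k : ℕ) : MemLp (fun x => (sineFun k x : ℂ)) 2 vol01 := by
  refine MemLp.of_bound (C := Real.sqrt 2) ?_ ?_
  · refine Continuous.aestronglyMeasurable ?_
    unfold sineFun
    fun_prop
  · refine ae_of_all _ fun x => ?_
    rw [Complex.norm_real, sineFun, norm_mul, Real.norm_of_nonneg (Real.sqrt_nonneg 2)]
    exact mul_le_of_le_one_right (Real.sqrt_nonneg 2) (Real.abs_sin_le_one _)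

/-- The eigenfunction `φ_k` as an element of `L²((0,1), ℂ)`. -/
def eigenfunction (k : ℕ) : StateSpace := (memLp_sineFun k).toLp _

/-- The coefficient `⟨f, φ_k⟩ = ∫ f(x) conj(φ_k(x)) dx`. -/
def coeff (k : ℕ) (f : StateSpace) : ℂ := ⟪eigenfunction k, f⟫_ℂ

/-- The eigenstate `Φ_k(t) = e^{-iλ_k t} φ_k`. -/
def eigenstate (k : ℕ) (t : ℝ) : StateSpace :=
  Complex.exp (-(Complex.I * eigenvalue k * t)) • eigenfunction k

/-- The group `e^{-iAt} f = ∑_{k ≥ 1} e^{-iλ_k t} ⟨f, φ_k⟩ φ_k`. -/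
def freeEvolution (t : ℝ) (f : StateSpace) : StateSpace :=
  ∑' k : ℕ, (Complex.exp (-(Complex.I * eigenvalue (k + 1) * t)) * coeff (k + 1) f) •
    eigenfunction (k + 1)

/-- `f ∈ H^s_{(0)}((0,1), ℂ) = D(A^{s/2})`, that is, `∑_{k ≥ 1} |k^s ⟨f, φ_k⟩|² < ∞`. -/
def MemHs (s : ℕ) (f : StateSpace) : Prop :=
  Summable fun k : ℕ => (((k + 1 : ℕ) : ℝ) ^ s * ‖coeff (k + 1) f‖) ^ 2

/-- The norm of `H^s_{(0)}`, for `f` in this space. -/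
def hsNorm (s : ℕ) (f : StateSpace) : ℝ :=
  Real.sqrt (∑' k : ℕ, (((k + 1 : ℕ) : ℝ) ^ s * ‖coeff (k + 1) f‖) ^ 2)

/-- `ψ ∈ C⁰([0,T], H^s_{(0)})`. -/
def ContinuousInHs (s : ℕ) (T : ℝ) (ψ : ℝ → StateSpace) : Prop :=
  (∀ t ∈ Icc 0 T, MemHs s (ψ t)) ∧
  ∀ t ∈ Icc 0 T, Tendsto (fun r => hsNorm s (ψ r - ψ t)) (𝓝[Icc 0 T] t) (𝓝 0)

/-! ### The bilinear Schrödinger equation -/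

open Classical in
/-- The product `μ f` in `L²((0,1), ℂ)`. It is defined for every `f` when `μ` is essentially
bounded, in particular when `μ ∈ H³((0,1), ℝ)`. -/
def dipoleMul (μ : ℝ → ℝ) (f : StateSpace) : StateSpace :=
  if h : MemLp (fun x => (μ x : ℂ) * f x) 2 vol01 then h.toLp _ else 0

/-- `ψ` is the weak solution on `[0,T]` of `i ∂ₜψ = -∂ₓₓψ - u(t) μ(x) ψ` with Dirichlet boundary
conditions and `ψ(0) = ψ₀`: `ψ ∈ C⁰([0,T], H³_{(0)})` and
`ψ(t) = e^{-iAt} ψ₀ + i ∫₀ᵗ e^{-iA(t-τ)} u(τ) μ ψ(τ) dτ` for all `t ∈ [0,T]`. -/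
def IsWeakSolution (T : ℝ) (μ u : ℝ → ℝ) (ψ₀ : StateSpace) (ψ : ℝ → StateSpace) : Prop :=
  ContinuousInHs 3 T ψ ∧
  ∀ t ∈ Icc 0 T, ψ t = freeEvolution t ψ₀ +
    Complex.I • ∫ τ in (0 : ℝ)..t, freeEvolution (t - τ) ((u τ : ℂ) • dipoleMul μ (ψ τ))

/-! ### The quantities attached to the dipolar moment -/

/-- The real number `⟨f φ_k, φ_k⟩` for a real function `f`. -/
def diagCoeff (f : ℝ → ℝ) (k : ℕ) : ℝ := ∫ x in Ioo (0 : ℝ) 1, f x * sineFun k x * sineFun k x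

/-- The number
`(⟨μφ_l,φ_l⟩ - ⟨μφ_k,φ_k⟩) ⟨(μ')²φ_j,φ_j⟩ + (⟨μφ_j,φ_j⟩ - ⟨μφ_l,φ_l⟩) ⟨(μ')²φ_k,φ_k⟩
  + (⟨μφ_k,φ_k⟩ - ⟨μφ_j,φ_j⟩) ⟨(μ')²φ_l,φ_l⟩`. -/
def calB (μ : ℝ → ℝ) (j k l : ℕ) : ℝ :=
  (diagCoeff μ l - diagCoeff μ k) * diagCoeff (fun x => weakDeriv μ x ^ 2) j
  + (diagCoeff μ j - diagCoeff μ l) * diagCoeff (fun x => weakDeriv μ x ^ 2) k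
  + (diagCoeff μ k - diagCoeff μ j) * diagCoeff (fun x => weakDeriv μ x ^ 2) l

end BilinearSchrodinger

end

namespace BilinearSchrodinger

/-! ### Absolutely continuous functions -/

/-! Everything is measured by the primitive s(t) = ∫₀ᵗ u. Let M be a C² representative of μ, and
compare the solution ψ issued from φ_k with the gauge state g(t) = e^{is(t)M} Φ_k(t), which absorbs
the control: g solves the equation of ψ up to a source κ of size O(|s|) in which u no longer appears
(`isDrivenFlow_gaugeState`). Since A and the multiplication by M are symmetric, the derivative of
⟨g, ψ⟩ is ⟨κ, ψ⟩. The part of κ linear in s is orthogonal to g, because (M''φ_k + 2M'φ_k')φ_k is the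
derivative of M'φ_k²; the quadratic part gives ⟨κ, g⟩ = -i d_k s². As ψ - g is O(∫|s|), the overlap
at time T is 1 - i d_k S + O(TS), where S = ∫₀ᵀ s² (`norm_inner_sub_one_add_le`).

If moreover ψ(T) = c_k Φ_k(T), the overlap equals c_k E_k with E_k = ⟨e^{iσM}φ_k, φ_k⟩ = 1 - iσ m_k
+ O(σ²) and σ = s(T) (`exists_overlap_expansion`). To leading order, c_k ≈ 1 + i(σ m_k - d_k S).

It remains to compare three such relations (`exists_small_no_phase`). Eliminating the common phase
between j and k gives σ(m_j - m_k) ≈ (d_j - d_k) S. As m_j ≠ m_k, this forces σ = O(S), so that all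
errors become small compared with S. If α is the additional factor of the third state, comparing l
with j gives Im α = βδ ≈ σ(m_l - m_j) + (d_j - d_l) S. Eliminating σ yields (m_j - m_k) βδ =
S·B_{j,k,l} plus an error of at most |B_{j,k,l}| S. The left side is nonzero and, by the choice of
β, of sign opposite to B_{j,k,l}, which is impossible.

The control is only square integrable and A is unbounded; the evolution equations are therefore used
coefficient by coefficient in the sine basis, with absolutely continuous functions and derivatives
that exist almost everywhere. -/

theorem absolutelyContinuousOnInterval_congr {X : Type*} [PseudoMetricSpace X] {f g : ℝ → X}
    {a b : ℝ} (hf : AbsolutelyContinuousOnInterval f a b) (h : ∀ x ∈ uIcc a b, f x = g x) :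
    AbsolutelyContinuousOnInterval g a b := by
  rw [absolutelyContinuousOnInterval_iff] at hf ⊢
  intro ε hε
  obtain ⟨δ, hδ, H⟩ := hf ε hε
  refine ⟨δ, hδ, fun E hE hE' => ?_⟩
  refine lt_of_eq_of_lt (Finset.sum_congr rfl fun i hi => ?_) (H E hE hE')
  rw [h _ (hE.1 i hi).1, h _ (hE.1 i hi).2]

theorem absolutelyContinuousOnInterval_lipschitz_comp {X Y : Type*} [PseudoMetricSpace X]
    [PseudoMetricSpace Y] {f : ℝ → X} {G : X → Y} {K : NNReal} {a b : ℝ}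
    (hG : LipschitzWith K G) (hf : AbsolutelyContinuousOnInterval f a b) :
    AbsolutelyContinuousOnInterval (fun t => G (f t)) a b := by
  unfold AbsolutelyContinuousOnInterval at hf ⊢
  refine squeeze_zero (fun E => Finset.sum_nonneg fun i _ => dist_nonneg) (fun E => ?_)
    (by simpa using hf.const_mul (K : ℝ))
  rw [Finset.mul_sum]
  exact Finset.sum_le_sum fun i _ => hG.dist_le_mul _ _

/-- The primitives of the real and imaginary parts are absolutely continuous; they are recombined
through the isometric embedding of ℝ in ℂ. -/
theorem absolutelyContinuousOnInterval_primitive {f : ℝ → ℂ} {a b : ℝ}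
    (hf : IntervalIntegrable f volume a b) :
    AbsolutelyContinuousOnInterval (fun x => ∫ v in a..x, f v) a b := by
  have hre : IntervalIntegrable (fun x => (f x).re) volume a b :=
    ⟨hf.1.re, hf.2.re⟩
  have him : IntervalIntegrable (fun x => (f x).im) volume a b :=
    ⟨hf.1.im, hf.2.im⟩
  have h1 := absolutelyContinuousOnInterval_lipschitz_comp
    Complex.isometry_ofReal.lipschitz
    (hre.absolutelyContinuousOnInterval_intervalIntegral (c := a) left_mem_uIcc)
  have h2 := (absolutelyContinuousOnInterval_lipschitz_comp
    Complex.isometry_ofReal.lipschitz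
    (him.absolutelyContinuousOnInterval_intervalIntegral (c := a) left_mem_uIcc)).const_smul
      Complex.I
  refine absolutelyContinuousOnInterval_congr (h1.add h2) fun x hx => ?_
  have hsub : uIcc a x ⊆ uIcc a b := uIcc_subset_uIcc_left hx
  have hfx := hf.mono_set hsub
  have hrex := hre.mono_set hsub
  have himx := him.mono_set hsub
  simp only [Pi.add_apply, smul_eq_mul]
  rw [← intervalIntegral.integral_ofReal, ← intervalIntegral.integral_ofReal,
    ← intervalIntegral.integral_const_mul, ← intervalIntegral.integral_add]
  · refine intervalIntegral.integral_congr fun v _ => ?_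
    simp only [mul_comm Complex.I, Complex.re_add_im]
  · exact ⟨hrex.1.ofReal, hrex.2.ofReal⟩
  · exact (show IntervalIntegrable (fun v => ((f v).im : ℂ)) volume a x from
      ⟨himx.1.ofReal, himx.2.ofReal⟩).const_mul _

/-- Fundamental theorem of calculus for complex valued absolutely continuous functions. -/
theorem sub_eq_integral_of_absolutelyContinuous {F f : ℝ → ℂ} {a b : ℝ}
    (hF : AbsolutelyContinuousOnInterval F a b) (hf : IntervalIntegrable f volume a b)
    (hd : ∀ᵐ x, x ∈ uIcc a b → HasDerivAt F (f x) x) {t : ℝ} (ht : t ∈ uIcc a b) :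
    F t = F a + ∫ x in a..t, f x := by
  obtain ⟨C, hC⟩ := (hF.sub
    (absolutelyContinuousOnInterval_primitive hf)).const_of_ae_hasDerivAt_zero (by
      filter_upwards [hd, hf.ae_hasDerivAt_integral] with x h1 h2 hx
      simpa using (h1 hx).sub (h2 hx a left_mem_uIcc))
  have h1 := hC t ht
  have h2 := hC a left_mem_uIcc
  simp only [Pi.sub_apply, intervalIntegral.integral_same, sub_zero] at h1 h2
  rw [h2, ← h1]; ring

theorem intervalIntegrable_of_continuousOn_mul {f x : ℝ → ℂ} {T : ℝ} (hT : 0 ≤ T)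
    (hf : ContinuousOn f (Icc 0 T)) (hx : IntervalIntegrable x volume 0 T) :
    IntervalIntegrable (fun t => f t * x t) volume 0 T :=
  hx.continuousOn_mul (by rwa [uIcc_of_le hT])

/-- Product rule for two primitives of integrable functions. -/
theorem mul_eq_integral_of_primitive {X Y x y : ℝ → ℂ} {T : ℝ} (hT : 0 ≤ T)
    (hx : IntervalIntegrable x volume 0 T) (hy : IntervalIntegrable y volume 0 T)
    (hX : ∀ t ∈ Icc 0 T, X t = X 0 + ∫ τ in (0 : ℝ)..t, x τ)
    (hY : ∀ t ∈ Icc 0 T, Y t = Y 0 + ∫ τ in (0 : ℝ)..t, y τ) :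
    IntervalIntegrable (fun t => x t * Y t + X t * y t) volume 0 T ∧
    ∀ t ∈ Icc 0 T, X t * Y t = X 0 * Y 0 + ∫ τ in (0 : ℝ)..t, (x τ * Y τ + X τ * y τ) := by
  have huI : uIcc 0 T = Icc 0 T := uIcc_of_le hT
  have key : ∀ {X x : ℝ → ℂ}, IntervalIntegrable x volume 0 T →
      (∀ t ∈ Icc 0 T, X t = X 0 + ∫ τ in (0 : ℝ)..t, x τ) →
      AbsolutelyContinuousOnInterval X 0 T ∧ ∀ᵐ t, t ∈ uIcc 0 T → HasDerivAt X (x t) t := by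
    intro X x hx hX
    constructor
    · refine absolutelyContinuousOnInterval_congr
        (f := fun t => X 0 + ∫ τ in (0 : ℝ)..t, x τ) ?_ fun t ht => (hX t (huI ▸ ht)).symm
      exact (((LipschitzWith.const (X 0)).lipschitzOnWith (s := uIcc 0 T)
        ).absolutelyContinuousOnInterval).add (absolutelyContinuousOnInterval_primitive hx)
    -- The integral formula for `X` holds only on `[0,T]`, so it determines the two-sided derivative
    -- at interior points only; the endpoints form a null set.
    · have h1 : ∀ᵐ t : ℝ, t ≠ 0 := by simp [ae_iff, measure_singleton]
      have h2 : ∀ᵐ t : ℝ, t ≠ T := by simp [ae_iff, measure_singleton]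
      filter_upwards [hx.ae_hasDerivAt_integral, h1, h2] with t h h1 h2 ht
      have hd := (h ht 0 left_mem_uIcc).const_add (X 0)
      refine hd.congr_of_eventuallyEq ?_
      rw [huI] at ht
      filter_upwards [Icc_mem_nhds (lt_of_le_of_ne ht.1 (Ne.symm h1)) (lt_of_le_of_ne ht.2 h2)]
        with r hr using hX r hr
  obtain ⟨aX, dX⟩ := key hx hX
  obtain ⟨aY, dY⟩ := key hy hY
  have hi : IntervalIntegrable (fun t => x t * Y t + X t * y t) volume 0 T :=
    (hx.mul_continuousOn aY.continuousOn).add (hy.continuousOn_mul aX.continuousOn)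
  refine ⟨hi, fun t ht => ?_⟩
  have := sub_eq_integral_of_absolutelyContinuous (aX.smul aY) hi (by
    filter_upwards [dX, dY] with t h1 h2 ht
    exact (h1 ht).mul (h2 ht)) (huI ▸ ht)
  simpa using this

/-! ### Continuous functions as elements of `L²((0,1), ℂ)` -/

instance : IsProbabilityMeasure vol01 := ⟨by simp [vol01]⟩

theorem integral_vol01 {E : Type*} [NormedAddCommGroup E] [NormedSpace ℝ E] (f : ℝ → E) :
    ∫ x, f x ∂vol01 = ∫ x in (0 : ℝ)..1, f x := by
  rw [vol01, intervalIntegral.integral_of_le zero_le_one, integral_Ioc_eq_integral_Ioo]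

theorem ae_vol01_mem : ∀ᵐ x ∂vol01, x ∈ Ioo (0 : ℝ) 1 :=
  ae_restrict_mem measurableSet_Ioo

theorem exists_norm_le_of_continuous {E : Type*} [NormedAddCommGroup E] {f : ℝ → E}
    (hf : Continuous f) : ∃ C : ℝ, 0 ≤ C ∧ ∀ x ∈ Icc (0 : ℝ) 1, ‖f x‖ ≤ C := by
  obtain ⟨C, hC⟩ := isCompact_Icc.exists_bound_of_continuousOn (s := Icc (0 : ℝ) 1)
    hf.continuousOn
  exact ⟨C, (norm_nonneg _).trans (hC 0 (by simp)), hC⟩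

theorem memLp_of_continuous {f : ℝ → ℂ} (hf : Continuous f) : MemLp f 2 vol01 := by
  obtain ⟨C, -, hC⟩ := exists_norm_le_of_continuous hf
  refine MemLp.of_bound (C := C) hf.aestronglyMeasurable ?_
  filter_upwards [ae_vol01_mem] with x hx using hC x (Ioo_subset_Icc_self hx)

open Classical in
/-- The class in `L²((0,1), ℂ)` of a square integrable function (and `0` otherwise). -/
noncomputable def toL2 (f : ℝ → ℂ) : StateSpace :=
  if h : MemLp f 2 vol01 then h.toLp f else 0

theorem coeFn_toL2 {f : ℝ → ℂ} (hf : Continuous f) : toL2 f =ᵐ[vol01] f := by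
  rw [toL2, dif_pos (memLp_of_continuous hf)]
  exact MemLp.coeFn_toLp _

theorem norm_le_of_ae_bound {f : StateSpace} {C : ℝ} (hC : 0 ≤ C)
    (h : ∀ᵐ x ∂vol01, ‖f x‖ ≤ C) : ‖f‖ ≤ C := by
  have := Lp.norm_le_of_ae_bound hC h
  simpa [measureUnivNNReal] using this

theorem norm_toL2_le {f : ℝ → ℂ} (hf : Continuous f) {C : ℝ} (hC : 0 ≤ C)
    (h : ∀ x ∈ Icc (0 : ℝ) 1, ‖f x‖ ≤ C) : ‖toL2 f‖ ≤ C := by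
  refine norm_le_of_ae_bound hC ?_
  filter_upwards [coeFn_toL2 hf, ae_vol01_mem] with x hx h1
  rw [hx]; exact h x (Ioo_subset_Icc_self h1)

theorem toL2_add {f g : ℝ → ℂ} (hf : Continuous f) (hg : Continuous g) :
    toL2 (fun x => f x + g x) = toL2 f + toL2 g := by
  refine Lp.ext ?_
  filter_upwards [coeFn_toL2 hf, coeFn_toL2 hg, coeFn_toL2 (hf.add hg),
    Lp.coeFn_add (toL2 f) (toL2 g)] with x h1 h2 h3 h4
  rw [h4, Pi.add_apply, h1, h2]; exact h3

theorem toL2_smul {f : ℝ → ℂ} (c : ℂ) (hf : Continuous f) :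
    toL2 (fun x => c * f x) = c • toL2 f := by
  refine Lp.ext ?_
  filter_upwards [coeFn_toL2 hf, coeFn_toL2 (f := fun x => c * f x) (by fun_prop),
    Lp.coeFn_smul c (toL2 f)] with x h1 h2 h3
  rw [h3, Pi.smul_apply, h1, h2, smul_eq_mul]

theorem toL2_sub {f g : ℝ → ℂ} (hf : Continuous f) (hg : Continuous g) :
    toL2 (fun x => f x - g x) = toL2 f - toL2 g := by
  have h1 := toL2_add hf (g := fun x => (-1 : ℂ) * g x) (by fun_prop)
  rw [toL2_smul _ hg] at h1
  rw [sub_eq_add_neg, ← neg_one_smul ℂ, ← h1]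
  congr 1; ext x; ring

theorem inner_toL2_left {f : ℝ → ℂ} (hf : Continuous f) (g : StateSpace) :
    ⟪toL2 f, g⟫_ℂ = ∫ x in (0 : ℝ)..1, starRingEnd ℂ (f x) * g x := by
  rw [L2.inner_def, ← integral_vol01]
  refine integral_congr_ae ?_
  filter_upwards [coeFn_toL2 hf] with x hx
  rw [hx, RCLike.inner_apply, mul_comm]

theorem inner_toL2 {f g : ℝ → ℂ} (hf : Continuous f) (hg : Continuous g) :
    ⟪toL2 f, toL2 g⟫_ℂ = ∫ x in (0 : ℝ)..1, starRingEnd ℂ (f x) * g x := by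
  rw [inner_toL2_left hf, ← integral_vol01, ← integral_vol01]
  refine integral_congr_ae ?_
  filter_upwards [coeFn_toL2 hg] with x hx
  rw [hx]

/-! ### The sine basis -/

theorem continuous_sineFun (k : ℕ) : Continuous (sineFun k) := by
  unfold sineFun; fun_prop

theorem eigenfunction_eq (k : ℕ) : eigenfunction k = toL2 (fun x => (sineFun k x : ℂ)) := by
  rw [toL2, dif_pos (memLp_sineFun k)]; rfl

theorem coeff_eq_integral (k : ℕ) (f : StateSpace) :
    coeff k f = ∫ x in (0 : ℝ)..1, (sineFun k x : ℂ) * f x := by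
  rw [coeff, eigenfunction_eq, inner_toL2_left (by have := continuous_sineFun k; fun_prop)]
  simp

theorem sineFun_zero_right (k : ℕ) : sineFun k 0 = 0 := by simp [sineFun]

theorem sineFun_one_right (k : ℕ) : sineFun k 1 = 0 := by simp [sineFun, Real.sin_nat_mul_pi]

theorem integral_cos_int_mul_pi {k : ℤ} (hk : k ≠ 0) :
    ∫ x in (0 : ℝ)..1, Real.cos (k * Real.pi * x) = 0 := by
  have h : (k * Real.pi : ℝ) ≠ 0 := by positivity
  have := intervalIntegral.integral_comp_mul_left (a := 0) (b := 1) Real.cos h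
  rw [this, integral_cos]
  simp [Real.sin_int_mul_pi]

theorem integral_sineFun_mul (j k : ℕ) (hj : 1 ≤ j) :
    ∫ x in (0 : ℝ)..1, sineFun j x * sineFun k x = if j = k then 1 else 0 := by
  have h : ∀ x, sineFun j x * sineFun k x =
      Real.cos (((j : ℤ) - (k : ℤ) : ℤ) * Real.pi * x)
        - Real.cos (((j : ℤ) + (k : ℤ) : ℤ) * Real.pi * x) := by
    intro x
    have h2 : Real.sqrt 2 * Real.sqrt 2 = 2 := Real.mul_self_sqrt (by norm_num)
    have e1 : (((j : ℤ) - (k : ℤ) : ℤ) : ℝ) * Real.pi * x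
      = j * Real.pi * x - k * Real.pi * x := by push_cast; ring
    have e2 : (((j : ℤ) + (k : ℤ) : ℤ) : ℝ) * Real.pi * x
      = j * Real.pi * x + k * Real.pi * x := by push_cast; ring
    rw [e1, e2, Real.cos_sub, Real.cos_add, sineFun, sineFun]
    linear_combination Real.sin (j * Real.pi * x) * Real.sin (k * Real.pi * x) * h2
  simp_rw [h]
  rw [intervalIntegral.integral_sub
    (Continuous.intervalIntegrable (by fun_prop) _ _)
    (Continuous.intervalIntegrable (by fun_prop) _ _),
    integral_cos_int_mul_pi (k := (j : ℤ) + k) (by omega)]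
  split_ifs with hjk
  · simp [hjk]
  · rw [integral_cos_int_mul_pi (by omega), sub_zero]

theorem orthonormal_eigenfunction : Orthonormal ℂ fun n : ℕ => eigenfunction (n + 1) := by
  rw [orthonormal_iff_ite]
  intro i j
  have hc : ∀ k, Continuous fun x => (sineFun k x : ℂ) := fun k =>
    Complex.continuous_ofReal.comp (continuous_sineFun k)
  rw [eigenfunction_eq, eigenfunction_eq, inner_toL2 (hc _) (hc _)]
  simp only [Complex.conj_ofReal, ← Complex.ofReal_mul]
  rw [intervalIntegral.integral_ofReal, integral_sineFun_mul _ _ (by omega)]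
  split_ifs <;> simp_all

/-- The Fourier coefficients on (-1,1) of the odd extension of `f` are multiples of its sine
coefficients, so they all vanish, and Parseval's identity applies to the extension. -/
theorem eq_zero_of_coeff_eq_zero (f : StateSpace) (hf : ∀ k : ℕ, 1 ≤ k → coeff k f = 0) :
    f = 0 := by
  have hm : MemLp f 2 (volume.restrict (Ioo (0 : ℝ) 1)) := Lp.memLp f
  set F : ℝ → ℂ := fun x => (Ioo (0 : ℝ) 1).indicator f x - (Ioo (0 : ℝ) 1).indicator f (-x)
    with hF
  have hp : MemLp ((Ioo (0 : ℝ) 1).indicator f) 2 volume :=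
    (memLp_indicator_iff_restrict measurableSet_Ioo).2 hm
  have hn : MemLp (fun x => (Ioo (0 : ℝ) 1).indicator f (-x)) 2 volume :=
    hp.comp_measurePreserving (Measure.measurePreserving_neg volume)
  have hFm : MemLp F 2 volume := hp.sub hn
  have hI : ∀ g : ℝ → ℂ, Continuous g → IntervalIntegrable
      (fun x => g x * (Ioo (0 : ℝ) 1).indicator f x) volume (-1) 1 := by
    intro g hg
    have h1 : IntervalIntegrable ((Ioo (0 : ℝ) 1).indicator f) volume (-1) 1 := by
      rw [intervalIntegrable_iff_integrableOn_Ioc_of_le (by norm_num)]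
      exact (hp.restrict _).integrable (by norm_num)
    exact h1.continuousOn_mul hg.continuousOn
  have hval : ∀ g : ℝ → ℂ, Continuous g →
      ∫ x in (-1 : ℝ)..1, g x * (Ioo (0 : ℝ) 1).indicator f x = ∫ x in (0 : ℝ)..1, g x * f x := by
    intro g hg
    rw [intervalIntegral.integral_of_le zero_le_one, integral_Ioc_eq_integral_Ioo,
      ← integral_indicator measurableSet_Ioo,
      intervalIntegral.integral_of_le (by norm_num), ← integral_indicator measurableSet_Ioc]
    congr 1
    ext x
    by_cases hx : x ∈ Ioo (0 : ℝ) 1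
    · have : x ∈ Ioc (-1 : ℝ) 1 := ⟨by linarith [hx.1], hx.2.le⟩
      simp [hx, this]
    · simp [hx, indicator]
  have hcoef : ∀ n : ℤ, fourierCoeffOn (by norm_num : (-1 : ℝ) < 1) F n = 0 := by
    intro n
    rw [fourierCoeffOn_eq_integral]
    have e : ∀ x : ℝ, fourier (-n) (x : AddCircle ((1 : ℝ) - -1)) =
        Complex.exp (-(n * Real.pi * x) * Complex.I) := by
      intro x
      rw [fourier_coe_apply]
      congr 1
      push_cast
      ring
    simp_rw [e, smul_eq_mul, hF, mul_sub]
    have hg1 : Continuous fun x : ℝ => Complex.exp (-(n * Real.pi * x) * Complex.I) := by fun_prop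
    have hg2 : Continuous fun x : ℝ => Complex.exp ((n * Real.pi * x) * Complex.I) := by fun_prop
    have hI2 := (hI _ hg2).comp_sub_left 0
    simp only [zero_sub, sub_neg_eq_add, zero_add] at hI2
    have hswap : ∫ x in (-1 : ℝ)..1, Complex.exp (-(n * Real.pi * x) * Complex.I) *
        (Ioo (0 : ℝ) 1).indicator f (-x) = ∫ x in (-1 : ℝ)..1,
          Complex.exp ((n * Real.pi * x) * Complex.I) * (Ioo (0 : ℝ) 1).indicator f x := by
      have := intervalIntegral.integral_comp_neg (a := -1) (b := 1)
        (fun x => Complex.exp ((n * Real.pi * x) * Complex.I) * (Ioo (0 : ℝ) 1).indicator f x)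
      simp only [neg_neg] at this
      rw [← this]
      congr 1; ext x; congr 2; push_cast; ring
    have hI2' : IntervalIntegrable (fun x : ℝ => Complex.exp (-(n * Real.pi * x) * Complex.I) *
        (Ioo (0 : ℝ) 1).indicator f (-x)) volume (-1) 1 := by
      refine IntervalIntegrable.symm ?_
      convert hI2 using 2 with x
      push_cast; ring_nf
    rw [intervalIntegral.integral_sub (hI _ hg1) hI2', hswap, hval _ hg1, hval _ hg2,
      ← intervalIntegral.integral_sub]
    · have e2 : ∀ x : ℝ, Complex.exp (-(n * Real.pi * x) * Complex.I) * f x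
          - Complex.exp ((n * Real.pi * x) * Complex.I) * f x
          = (-2 * Complex.I) * ((Real.sin (n * Real.pi * x) : ℂ) * f x) := by
        intro x
        rw [neg_mul, Complex.exp_neg, Complex.ofReal_sin, Complex.sin]
        rw [show -((n * Real.pi * x : ℝ) : ℂ) * Complex.I = -((n * Real.pi * x) * Complex.I) by
          push_cast; ring, show ((n * Real.pi * x : ℝ) : ℂ) * Complex.I
            = (n * Real.pi * x) * Complex.I by push_cast; ring, Complex.exp_neg]
        linear_combination ((Complex.exp (n * Real.pi * x * Complex.I))⁻¹ * f x
          - Complex.exp (n * Real.pi * x * Complex.I) * f x) * Complex.I_sq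
      simp_rw [e2]
      rw [intervalIntegral.integral_const_mul]
      have hs : ∫ x in (0 : ℝ)..1, (Real.sin (n * Real.pi * x) : ℂ) * f x = 0 := by
        have hnat : ∀ m : ℕ, ∫ x in (0 : ℝ)..1, (Real.sin (m * Real.pi * x) : ℂ) * f x = 0 := by
          intro m
          rcases Nat.eq_zero_or_pos m with rfl | hm
          · simp
          · have h := hf m hm
            rw [coeff_eq_integral] at h
            simp only [sineFun, Complex.ofReal_mul, mul_assoc] at h
            rw [intervalIntegral.integral_const_mul] at h
            simpa [mul_assoc] using h
        rcases Int.natAbs_eq n with h | h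
        · rw [h]; simpa using hnat n.natAbs
        · rw [h]
          have := hnat n.natAbs
          have e3 : ∀ x : ℝ, (Real.sin (((-(n.natAbs : ℤ) : ℤ) : ℝ) * Real.pi * x) : ℂ) * f x
            = -((Real.sin (n.natAbs * Real.pi * x) : ℂ) * f x) := by
            intro x
            rw [← neg_mul, ← Complex.ofReal_neg, ← Real.sin_neg]
            congr 3; rw [Int.cast_neg, Int.cast_natCast]; ring
          simp_rw [e3, intervalIntegral.integral_neg]
          rw [this, neg_zero]
      rw [hs]; simp
    · have hf1 : IntervalIntegrable f volume 0 1 := by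
        rw [intervalIntegrable_iff_integrableOn_Ioo_of_le zero_le_one]
        exact hm.integrable (by norm_num)
      exact hf1.continuousOn_mul hg1.continuousOn
    · have hf1 : IntervalIntegrable f volume 0 1 := by
        rw [intervalIntegrable_iff_integrableOn_Ioo_of_le zero_le_one]
        exact hm.integrable (by norm_num)
      exact hf1.continuousOn_mul hg2.continuousOn
  have hpars := (hasSum_sq_fourierCoeffOn (by norm_num : (-1 : ℝ) < 1) (hFm.restrict _)).tsum_eq
  simp only [hcoef, norm_zero, ne_eq, OfNat.ofNat_ne_zero, not_false_eq_true, zero_pow, tsum_zero]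
    at hpars
  have hzero : ∫ x in (-1 : ℝ)..1, ‖F x‖ ^ 2 = 0 := by
    rw [smul_eq_mul] at hpars
    rcases mul_eq_zero.1 hpars.symm with h | h
    · norm_num at h
    · exact h
  rw [intervalIntegral.integral_of_le (by norm_num), integral_eq_zero_iff_of_nonneg
    (fun x => by positivity) ((hFm.restrict _).integrable_norm_pow (by norm_num))] at hzero
  refine Lp.ext ?_
  have h0 := ae_restrict_of_ae_restrict_of_subset
    (show Ioo (0 : ℝ) 1 ⊆ Ioc (-1 : ℝ) 1 from fun x hx => ⟨by linarith [hx.1], hx.2.le⟩) hzero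
  have h0' : ∀ᵐ x ∂vol01, ‖F x‖ ^ 2 = 0 := h0
  filter_upwards [h0', ae_vol01_mem, Lp.coeFn_zero ℂ 2 vol01] with x h1 h2 h3
  rw [h3]
  have h4 : F x = 0 := by simpa using h1
  have h5 : -x ∉ Ioo (0 : ℝ) 1 := fun h => by linarith [h.1, h2.1]
  simpa [hF, h2, h5] using h4

/-- The eigenfunctions of the Dirichlet Laplacian form a Hilbert basis. -/
noncomputable def sineBasis : HilbertBasis ℕ ℂ StateSpace :=
  HilbertBasis.mkOfOrthogonalEqBot orthonormal_eigenfunction (by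
    rw [Submodule.eq_bot_iff]
    intro f hf
    refine eq_zero_of_coeff_eq_zero f fun k hk => ?_
    obtain ⟨n, rfl⟩ : ∃ n, k = n + 1 := ⟨k - 1, by omega⟩
    exact (Submodule.mem_orthogonal _ _).1 hf _ (Submodule.subset_span ⟨n, rfl⟩))

theorem sineBasis_apply (n : ℕ) : sineBasis n = eigenfunction (n + 1) :=
  congrFun (HilbertBasis.coe_mkOfOrthogonalEqBot orthonormal_eigenfunction _) n

/-! ### Multiplication by the dipolar moment -/

theorem memLp_ofReal_mul {M : ℝ → ℝ} (hM : Continuous M) (f : StateSpace) :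
    MemLp (fun x => (M x : ℂ) * f x) 2 vol01 := by
  obtain ⟨C, -, hC⟩ := exists_norm_le_of_continuous hM
  refine (Lp.memLp f).of_le_mul (c := C)
    ((Complex.continuous_ofReal.comp hM).aestronglyMeasurable.mul (Lp.aestronglyMeasurable f)) ?_
  filter_upwards [ae_vol01_mem] with x hx
  rw [norm_mul, Complex.norm_real]
  exact mul_le_mul_of_nonneg_right (hC x (Ioo_subset_Icc_self hx)) (norm_nonneg _)

/-- Multiplication by a continuous real function, as a bounded operator of `L²((0,1), ℂ)`. -/
noncomputable def mulOp (M : ℝ → ℝ) (hM : Continuous M) : StateSpace →L[ℂ] StateSpace :=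
  LinearMap.mkContinuousOfExistsBound
    { toFun := fun f => (memLp_ofReal_mul hM f).toLp _
      map_add' := fun f g => by
        refine Lp.ext ?_
        filter_upwards [(memLp_ofReal_mul hM (f + g)).coeFn_toLp, (memLp_ofReal_mul hM f).coeFn_toLp,
          (memLp_ofReal_mul hM g).coeFn_toLp, Lp.coeFn_add f g,
          Lp.coeFn_add ((memLp_ofReal_mul hM f).toLp _) ((memLp_ofReal_mul hM g).toLp _)]
          with x h1 h2 h3 h4 h5
        rw [h5, Pi.add_apply, h1, h2, h3, h4, Pi.add_apply, mul_add]
      map_smul' := fun c f => by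
        refine Lp.ext ?_
        filter_upwards [(memLp_ofReal_mul hM (c • f)).coeFn_toLp,
          (memLp_ofReal_mul hM f).coeFn_toLp, Lp.coeFn_smul c f,
          Lp.coeFn_smul c ((memLp_ofReal_mul hM f).toLp _)] with x h1 h2 h3 h4
        rw [RingHom.id_apply, h4, Pi.smul_apply, h1, h2, h3, Pi.smul_apply, smul_eq_mul,
          smul_eq_mul, mul_left_comm] }
    (by
      obtain ⟨C, hC0, hC⟩ := exists_norm_le_of_continuous hM
      refine ⟨C, fun f => ?_⟩
      refine Lp.norm_le_mul_norm_of_ae_le_mul ?_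
      filter_upwards [(memLp_ofReal_mul hM f).coeFn_toLp, ae_vol01_mem] with x h1 hx
      simp only [LinearMap.coe_mk, AddHom.coe_mk]
      rw [h1, norm_mul, Complex.norm_real]
      exact mul_le_mul_of_nonneg_right (hC x (Ioo_subset_Icc_self hx)) (norm_nonneg _))

theorem mulOp_apply {M : ℝ → ℝ} (hM : Continuous M) (f : StateSpace) :
    mulOp M hM f = (memLp_ofReal_mul hM f).toLp _ := rfl

theorem coeFn_mulOp {M : ℝ → ℝ} (hM : Continuous M) (f : StateSpace) :
    mulOp M hM f =ᵐ[vol01] fun x => (M x : ℂ) * f x :=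
  (memLp_ofReal_mul hM f).coeFn_toLp

theorem dipoleMul_eq_mulOp {μ M : ℝ → ℝ} (hM : Continuous M) (h : μ =ᵐ[vol01] M)
    (f : StateSpace) : dipoleMul μ f = mulOp M hM f := by
  have hae : (fun x => (μ x : ℂ) * f x) =ᵐ[vol01] fun x => (M x : ℂ) * f x := by
    filter_upwards [h] with x hx; rw [hx]
  have hm : MemLp (fun x => (μ x : ℂ) * f x) 2 vol01 :=
    (memLp_congr_ae hae).2 (memLp_ofReal_mul hM f)
  rw [dipoleMul, dif_pos hm, mulOp_apply]
  exact MemLp.toLp_congr _ _ hae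

theorem mulOp_toL2 {M : ℝ → ℝ} (hM : Continuous M) {f : ℝ → ℂ} (hf : Continuous f) :
    mulOp M hM (toL2 f) = toL2 (fun x => M x * f x) := by
  refine Lp.ext ?_
  filter_upwards [coeFn_mulOp hM (toL2 f), coeFn_toL2 hf,
    coeFn_toL2 (f := fun x => M x * f x) (by fun_prop)] with x h1 h2 h3
  rw [h1, h2, h3]

theorem inner_mulOp_left {M : ℝ → ℝ} (hM : Continuous M) (f g : StateSpace) :
    ⟪mulOp M hM f, g⟫_ℂ = ⟪f, mulOp M hM g⟫_ℂ := by
  rw [L2.inner_def, L2.inner_def]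
  refine integral_congr_ae ?_
  filter_upwards [coeFn_mulOp hM f, coeFn_mulOp hM g] with x h1 h2
  rw [h1, h2, RCLike.inner_apply, RCLike.inner_apply, map_mul, Complex.conj_ofReal]
  ring

/-! ### The phases `e^{iσM}` -/

/-- The function `e^{iσM} f` of `L²((0,1), ℂ)`. -/
noncomputable def phaseMul (M : ℝ → ℝ) (f : ℝ → ℂ) (σ : ℝ) : StateSpace :=
  toL2 fun x => Complex.exp (Complex.I * (σ * M x : ℝ)) * f x

theorem norm_exp_I_mul (r : ℝ) : ‖Complex.exp (Complex.I * r)‖ = 1 := by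
  rw [mul_comm, Complex.norm_exp_ofReal_mul_I]

theorem norm_phaseMul_le {M : ℝ → ℝ} (hM : Continuous M) {f : ℝ → ℂ} (hf : Continuous f) {C : ℝ}
    (hC : 0 ≤ C) (h : ∀ x ∈ Icc (0 : ℝ) 1, ‖f x‖ ≤ C) (σ : ℝ) : ‖phaseMul M f σ‖ ≤ C := by
  refine norm_toL2_le (by fun_prop) hC fun x hx => ?_
  rw [norm_mul, norm_exp_I_mul, one_mul]
  exact h x hx

theorem inner_phaseMul {M : ℝ → ℝ} (hM : Continuous M) {f g : ℝ → ℂ} (hf : Continuous f)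
    (hg : Continuous g) (σ : ℝ) :
    ⟪phaseMul M f σ, phaseMul M g σ⟫_ℂ = ∫ x in (0 : ℝ)..1, starRingEnd ℂ (f x) * g x := by
  rw [phaseMul, phaseMul, inner_toL2 (by fun_prop) (by fun_prop)]
  refine intervalIntegral.integral_congr fun x _ => ?_
  have h : starRingEnd ℂ (Complex.exp (Complex.I * (σ * M x : ℝ)))
      * Complex.exp (Complex.I * (σ * M x : ℝ)) = 1 := by
    rw [mul_comm, Complex.mul_conj, Complex.normSq_eq_norm_sq, norm_exp_I_mul]
    simp
  simp only [map_mul]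
  linear_combination starRingEnd ℂ (f x) * g x * h

theorem norm_exp_sub_exp_le (a b : ℝ) :
    ‖Complex.exp (Complex.I * a) - Complex.exp (Complex.I * b)‖ ≤ |a - b| := by
  have h : Complex.exp (Complex.I * a) - Complex.exp (Complex.I * b)
      = Complex.exp (Complex.I * b) * (Complex.exp (Complex.I * (a - b : ℝ)) - 1) := by
    rw [mul_sub, ← Complex.exp_add, mul_one]
    congr 2; push_cast; ring
  rw [h, norm_mul, norm_exp_I_mul, one_mul]
  exact Real.norm_exp_I_mul_ofReal_sub_one_le

/-- Composed with the absolutely continuous primitive of the control, a Lipschitz map stays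
absolutely continuous. This is what allows the fundamental theorem of calculus for the coefficients
of the gauge state. -/
theorem exists_lipschitzWith_phaseMul {M : ℝ → ℝ} (hM : Continuous M) {f : ℝ → ℂ}
    (hf : Continuous f) : ∃ K, LipschitzWith K (phaseMul M f) := by
  obtain ⟨C, hC0, hC⟩ := exists_norm_le_of_continuous (f := fun x => (M x : ℂ) * f x) (by fun_prop)
  refine ⟨C.toNNReal, LipschitzWith.of_dist_le_mul fun a b => ?_⟩
  rw [dist_eq_norm, Real.coe_toNNReal C hC0, phaseMul, phaseMul,
    ← toL2_sub (by fun_prop) (by fun_prop)]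
  refine norm_toL2_le (by fun_prop) (by positivity) fun x hx => ?_
  rw [← sub_mul, norm_mul]
  calc _ ≤ |a * M x - b * M x| * ‖f x‖ := by gcongr; exact norm_exp_sub_exp_le _ _
    _ = ‖(M x : ℂ) * f x‖ * |a - b| := by
      rw [← sub_mul, abs_mul, norm_mul, Complex.norm_real, Real.norm_eq_abs]; ring
    _ ≤ C * dist a b := by rw [Real.dist_eq]; gcongr; exact hC x hx

/-- The pointwise derivative is also the derivative in L², because `M` and `f` are bounded on [0,1]
and the Taylor remainder of the exponential is then quadratic in the increment uniformly in `x`. -/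
theorem hasDerivAt_phaseMul {M : ℝ → ℝ} (hM : Continuous M) {f : ℝ → ℂ} (hf : Continuous f)
    (σ : ℝ) :
    HasDerivAt (phaseMul M f) (phaseMul M (fun x => Complex.I * (M x * f x)) σ) σ := by
  obtain ⟨C, hC0, hC⟩ := exists_norm_le_of_continuous hM
  obtain ⟨D, hD0, hD⟩ := exists_norm_le_of_continuous hf
  rw [hasDerivAt_iff_isLittleO]
  refine Asymptotics.IsBigO.trans_isLittleO (g := fun r => ‖r - σ‖ ^ 2) ?_ ?_
  · refine Asymptotics.IsBigO.of_bound (C ^ 2 * D) ?_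
    -- The radius ensures |(r - σ) M x| ≤ 1, the range where the quadratic remainder bound for the
    -- exponential is available.
    filter_upwards [Metric.ball_mem_nhds σ (show 0 < 1 / (C + 1) by positivity)] with r hr
    rw [Metric.mem_ball, Real.dist_eq, lt_div_iff₀ (by positivity)] at hr
    have hfun : phaseMul M f r - phaseMul M f σ - (r - σ) • phaseMul M
        (fun x => Complex.I * (M x * f x)) σ = toL2 fun x =>
          (Complex.exp (Complex.I * (r * M x : ℝ)) * f x
            - Complex.exp (Complex.I * (σ * M x : ℝ)) * f x)
            - ((r - σ : ℝ) : ℂ) * (Complex.exp (Complex.I * (σ * M x : ℝ)) *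
              (Complex.I * (M x * f x))) := by
      rw [toL2_sub (by fun_prop) (by fun_prop), toL2_sub (by fun_prop) (by fun_prop),
        toL2_smul _ (by fun_prop)]
      rfl
    rw [hfun]
    refine norm_toL2_le (by fun_prop) (by positivity) fun x hx => ?_
    have hfac : (Complex.exp (Complex.I * (r * M x : ℝ)) * f x
            - Complex.exp (Complex.I * (σ * M x : ℝ)) * f x)
            - ((r - σ : ℝ) : ℂ) * (Complex.exp (Complex.I * (σ * M x : ℝ)) *
              (Complex.I * (M x * f x)))
        = Complex.exp (Complex.I * (σ * M x : ℝ)) *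
          ((Complex.exp (Complex.I * ((r - σ) * M x : ℝ)) - 1 - Complex.I * ((r - σ) * M x : ℝ))
            * f x) := by
      have : Complex.exp (Complex.I * (r * M x : ℝ)) = Complex.exp (Complex.I * (σ * M x : ℝ)) *
          Complex.exp (Complex.I * ((r - σ) * M x : ℝ)) := by
        rw [← Complex.exp_add]; congr 1; push_cast; ring
      rw [this]; push_cast; ring
    have hn : ‖Complex.I * ((r - σ) * M x : ℝ)‖ = |r - σ| * |M x| := by
      rw [norm_mul, Complex.norm_I, one_mul, Complex.norm_real, Real.norm_eq_abs, abs_mul]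
    have hMx : |M x| ≤ C := hC x hx
    have hle : ‖Complex.I * ((r - σ) * M x : ℝ)‖ ≤ 1 := by
      rw [hn]; nlinarith [abs_nonneg (r - σ)]
    rw [hfac, norm_mul, norm_exp_I_mul, one_mul, norm_mul, norm_pow, norm_norm, Real.norm_eq_abs]
    calc _ ≤ ‖Complex.I * ((r - σ) * M x : ℝ)‖ ^ 2 * ‖f x‖ := by
          gcongr; exact Complex.norm_exp_sub_one_sub_id_le hle
      _ = |M x| ^ 2 * ‖f x‖ * |r - σ| ^ 2 := by rw [hn]; ring
      _ ≤ C ^ 2 * D * |r - σ| ^ 2 := by gcongr; exact hD x hx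
  · have := (Asymptotics.isLittleO_norm_pow_id (E' := ℝ) one_lt_two).comp_tendsto
      (show Tendsto (fun r => r - σ) (𝓝 σ) (𝓝 0) by
        simpa using (continuous_id.sub continuous_const).tendsto (f := fun r : ℝ => r - σ) σ)
    exact this

/-! ### Integration by parts -/

theorem hasDerivAt_sineFun (k : ℕ) (x : ℝ) :
    HasDerivAt (sineFun k) (Real.sqrt 2 * (Real.cos (k * Real.pi * x) * (k * Real.pi))) x := by
  have h : HasDerivAt (fun x : ℝ => k * Real.pi * x) (k * Real.pi) x := by
    simpa using (hasDerivAt_id x).const_mul (k * Real.pi)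
  exact (h.sin).const_mul _

theorem hasDerivAt_deriv_sineFun (k : ℕ) (x : ℝ) :
    HasDerivAt (fun x => Real.sqrt 2 * (Real.cos (k * Real.pi * x) * (k * Real.pi)))
      (-(eigenvalue k * sineFun k x)) x := by
  have h : HasDerivAt (fun x : ℝ => k * Real.pi * x) (k * Real.pi) x := by
    simpa using (hasDerivAt_id x).const_mul (k * Real.pi)
  refine (((h.cos).mul_const (k * Real.pi)).const_mul (Real.sqrt 2)).congr_deriv ?_
  rw [eigenvalue, sineFun]; ring

/-- Green's formula: the integrand has the primitive g φ_k' - φ_k g', which vanishes at 0 and 1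
because both functions do. -/
theorem eigenvalue_mul_inner_toL2 (k : ℕ) {g g₁ g₂ : ℝ → ℂ} (h₁ : ∀ x, HasDerivAt g (g₁ x) x)
    (h₂ : ∀ x, HasDerivAt g₁ (g₂ x) x) (hc : Continuous g₂) (h0 : g 0 = 0) (h1 : g 1 = 0) :
    (eigenvalue k : ℂ) * ⟪eigenfunction k, toL2 g⟫_ℂ
      = -⟪eigenfunction k, toL2 g₂⟫_ℂ := by
  have hs : Continuous fun x => (sineFun k x : ℂ) :=
    Complex.continuous_ofReal.comp (continuous_sineFun k)
  have hg : Continuous g := continuous_iff_continuousAt.2 fun x => (h₁ x).continuousAt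
  rw [eigenfunction_eq, inner_toL2 hs hg, inner_toL2 hs hc]
  simp only [Complex.conj_ofReal]
  have hd : ∀ x ∈ uIcc (0 : ℝ) 1, HasDerivAt (fun x => g x *
      ((Real.sqrt 2 * (Real.cos (k * Real.pi * x) * (k * Real.pi)) : ℝ) : ℂ) - (sineFun k x : ℂ) * g₁ x)
      (-(eigenvalue k * ((sineFun k x : ℂ) * g x)) - (sineFun k x : ℂ) * g₂ x) x := by
    intro x _
    refine (((h₁ x).mul (hasDerivAt_deriv_sineFun k x).ofReal_comp).sub
      ((hasDerivAt_sineFun k x).ofReal_comp.mul (h₂ x))).congr_deriv ?_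
    push_cast
    ring
  have hi1 : IntervalIntegrable (fun x => -((eigenvalue k : ℂ) * ((sineFun k x : ℂ) * g x)))
      volume 0 1 := Continuous.intervalIntegrable (by fun_prop) _ _
  have hi2 : IntervalIntegrable (fun x => (sineFun k x : ℂ) * g₂ x)
      volume 0 1 := Continuous.intervalIntegrable (by fun_prop) _ _
  have := intervalIntegral.integral_eq_sub_of_hasDerivAt hd (hi1.sub hi2)
  rw [intervalIntegral.integral_sub hi1 hi2, intervalIntegral.integral_neg,
    intervalIntegral.integral_const_mul, sineFun_one_right, sineFun_zero_right, h0, h1] at this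
  simp only [zero_mul, Complex.ofReal_zero, sub_zero] at this
  linear_combination -this

/-! ### Bilinear systems in a Hilbert space -/

section Abstract

variable {H : Type*} [NormedAddCommGroup H] [InnerProductSpace ℂ H]

/-- `g` solves `∂ₜ g = -iΛ g + i u M g + κ` on `[0,T]`, where `Λ` is the diagonal operator with
eigenvalues `lam n` in the basis `b`: Duhamel's formula for each coefficient. -/
def IsDrivenFlow (b : HilbertBasis ℕ ℂ H) (lam : ℕ → ℝ) (M : H →L[ℂ] H) (u : ℝ → ℝ) (T : ℝ)
    (g κ : ℝ → H) : Prop :=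
  ∀ n, ∀ t ∈ Icc 0 T, Complex.exp (Complex.I * (lam n * t : ℝ)) * ⟪b n, g t⟫_ℂ = ⟪b n, g 0⟫_ℂ +
    ∫ τ in (0 : ℝ)..t, Complex.exp (Complex.I * (lam n * τ : ℝ)) *
      ⟪b n, (Complex.I * u τ) • M (g τ) + κ τ⟫_ℂ

/-- The bound does not depend on `s`; it provides the dominating function when partial sums over the
basis are integrated in time and passed to the limit. -/
theorem norm_sum_inner_mul_inner_le (b : HilbertBasis ℕ ℂ H) (s : Finset ℕ) (x y : H) :
    ‖∑ n ∈ s, ⟪x, b n⟫_ℂ * ⟪b n, y⟫_ℂ‖ ≤ ‖x‖ * ‖y‖ := by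
  calc _ ≤ ∑ n ∈ s, ‖⟪b n, x⟫_ℂ‖ * ‖⟪b n, y⟫_ℂ‖ := by
        refine norm_sum_le_of_le _ fun n _ => ?_
        rw [norm_mul, norm_inner_symm]
    _ ≤ Real.sqrt (∑ n ∈ s, ‖⟪b n, x⟫_ℂ‖ ^ 2) * Real.sqrt (∑ n ∈ s, ‖⟪b n, y⟫_ℂ‖ ^ 2) :=
        Real.sum_mul_le_sqrt_mul_sqrt _ _ _
    _ ≤ Real.sqrt (‖x‖ ^ 2) * Real.sqrt (‖y‖ ^ 2) := by
        gcongr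
        · exact b.orthonormal.sum_inner_products_le x
        · exact b.orthonormal.sum_inner_products_le y
    _ = ‖x‖ * ‖y‖ := by rw [Real.sqrt_sq (norm_nonneg _), Real.sqrt_sq (norm_nonneg _)]

variable {b : HilbertBasis ℕ ℂ H} {lam : ℕ → ℝ} {M : H →L[ℂ] H} {u : ℝ → ℝ} {T : ℝ}
  {g κ ψ : ℝ → H}

theorem IsDrivenFlow.intervalIntegrable (hT : 0 ≤ T) (hu : IntervalIntegrable u volume 0 T)
    (hg : ContinuousOn g (Icc 0 T)) (hκ : ContinuousOn κ (Icc 0 T)) (n : ℕ) :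
    IntervalIntegrable (fun τ => Complex.exp (Complex.I * (lam n * τ : ℝ)) *
      ⟪b n, (Complex.I * u τ) • M (g τ) + κ τ⟫_ℂ) volume 0 T := by
  have hu' : IntervalIntegrable (fun τ => (u τ : ℂ)) volume 0 T := ⟨hu.1.ofReal, hu.2.ofReal⟩
  have hMg : ContinuousOn (fun τ => M (g τ)) (Icc 0 T) := M.continuous.comp_continuousOn hg
  have h1 : IntervalIntegrable (fun τ => (Complex.exp (Complex.I * (lam n * τ : ℝ)) *
      (Complex.I * ⟪b n, M (g τ)⟫_ℂ)) * u τ) volume 0 T := by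
    refine intervalIntegrable_of_continuousOn_mul hT ?_ hu'
    have : ContinuousOn (fun τ => ⟪b n, M (g τ)⟫_ℂ) (Icc 0 T) :=
      continuousOn_const.inner hMg
    fun_prop
  have h2 : IntervalIntegrable (fun τ => Complex.exp (Complex.I * (lam n * τ : ℝ)) *
      ⟪b n, κ τ⟫_ℂ) volume 0 T := by
    refine ContinuousOn.intervalIntegrable ?_
    rw [uIcc_of_le hT]
    have : ContinuousOn (fun τ => ⟪b n, κ τ⟫_ℂ) (Icc 0 T) := continuousOn_const.inner hκ
    fun_prop
  refine (h1.add h2).congr fun τ _ => ?_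
  simp only [inner_add_right, inner_smul_right]
  ring

/-- Multiplied by e^{iλ_n t}, the coefficients are primitives of integrable functions, so the
product rule applies to one of them and the conjugate of the other. The two phases cancel in the
product, and the unbounded eigenvalues disappear. -/
theorem inner_coeff_of_isDrivenFlow (hT : 0 ≤ T) (hu : IntervalIntegrable u volume 0 T)
    (hg : ContinuousOn g (Icc 0 T)) (hκ : ContinuousOn κ (Icc 0 T))
    (hψ : ContinuousOn ψ (Icc 0 T)) (fg : IsDrivenFlow b lam M u T g κ)
    (fψ : IsDrivenFlow b lam M u T ψ fun _ => 0) (n : ℕ) :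
    IntervalIntegrable (fun τ => ⟪g τ, b n⟫_ℂ * ⟪b n, (Complex.I * u τ) • M (ψ τ)⟫_ℂ
      + ⟪(Complex.I * u τ) • M (g τ) + κ τ, b n⟫_ℂ * ⟪b n, ψ τ⟫_ℂ) volume 0 T ∧
    ∀ t ∈ Icc 0 T, ⟪g t, b n⟫_ℂ * ⟪b n, ψ t⟫_ℂ = ⟪g 0, b n⟫_ℂ * ⟪b n, ψ 0⟫_ℂ +
      ∫ τ in (0 : ℝ)..t, (⟪g τ, b n⟫_ℂ * ⟪b n, (Complex.I * u τ) • M (ψ τ)⟫_ℂ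
      + ⟪(Complex.I * u τ) • M (g τ) + κ τ, b n⟫_ℂ * ⟪b n, ψ τ⟫_ℂ) := by
  have hx := IsDrivenFlow.intervalIntegrable (b := b) (lam := lam) (M := M) hT hu hψ
    (continuousOn_const (c := (0 : H))) n
  have hy := IsDrivenFlow.intervalIntegrable (b := b) (lam := lam) (M := M) hT hu hg hκ n
  have hyc : IntervalIntegrable (fun τ => starRingEnd ℂ (Complex.exp (Complex.I * (lam n * τ : ℝ)) *
      ⟪b n, (Complex.I * u τ) • M (g τ) + κ τ⟫_ℂ)) volume 0 T :=
    ⟨Complex.conjCLE.toContinuousLinearMap.integrable_comp hy.1,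
      Complex.conjCLE.toContinuousLinearMap.integrable_comp hy.2⟩
  have hE : ∀ τ : ℝ, starRingEnd ℂ (Complex.exp (Complex.I * (lam n * τ : ℝ))) *
      Complex.exp (Complex.I * (lam n * τ : ℝ)) = 1 := by
    intro τ
    rw [mul_comm, Complex.mul_conj, Complex.normSq_eq_norm_sq, norm_exp_I_mul]
    simp
  obtain ⟨hi, hp⟩ := mul_eq_integral_of_primitive
    (X := fun t => Complex.exp (Complex.I * (lam n * t : ℝ)) * ⟪b n, ψ t⟫_ℂ)
    (Y := fun t => starRingEnd ℂ (Complex.exp (Complex.I * (lam n * t : ℝ)) * ⟪b n, g t⟫_ℂ))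
    hT hx hyc
    (fun t ht => by rw [fψ n t ht]; simp)
    (fun t ht => by
      rw [fg n t ht, map_add]
      congr 1
      · simp
      · rw [intervalIntegral.integral_of_le ht.1, intervalIntegral.integral_of_le ht.1,
          integral_conj])
  have hcong : ∀ τ : ℝ, Complex.exp (Complex.I * (lam n * τ : ℝ)) *
        ⟪b n, (Complex.I * u τ) • M (ψ τ) + 0⟫_ℂ *
        starRingEnd ℂ (Complex.exp (Complex.I * (lam n * τ : ℝ)) * ⟪b n, g τ⟫_ℂ) +
      Complex.exp (Complex.I * (lam n * τ : ℝ)) * ⟪b n, ψ τ⟫_ℂ *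
        starRingEnd ℂ (Complex.exp (Complex.I * (lam n * τ : ℝ)) *
          ⟪b n, (Complex.I * u τ) • M (g τ) + κ τ⟫_ℂ)
      = ⟪g τ, b n⟫_ℂ * ⟪b n, (Complex.I * u τ) • M (ψ τ)⟫_ℂ
      + ⟪(Complex.I * u τ) • M (g τ) + κ τ, b n⟫_ℂ * ⟪b n, ψ τ⟫_ℂ := by
    intro τ
    rw [map_mul, map_mul, inner_conj_symm, inner_conj_symm, add_zero]
    linear_combination (⟪b n, (Complex.I * u τ) • M (ψ τ)⟫_ℂ * ⟪g τ, b n⟫_ℂ + ⟪b n, ψ τ⟫_ℂ *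
      ⟪(Complex.I * u τ) • M (g τ) + κ τ, b n⟫_ℂ) * hE τ
  refine ⟨hi.congr fun τ _ => hcong τ, fun t ht => ?_⟩
  have h := hp t ht
  have hE' := hE t
  simp_rw [hcong] at h
  simp only [mul_zero, Complex.ofReal_zero, Complex.exp_zero, one_mul, inner_conj_symm,
    map_mul] at h
  rw [mul_comm ⟪g 0, b n⟫_ℂ, ← h]
  linear_combination - ⟪b n, ψ t⟫_ℂ * ⟪g t, b n⟫_ℂ * hE'

/-- Sum the coefficient identities over the basis. The two terms containing `u` cancel in the limit
by the symmetry of `M`, and only the source is left. -/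
theorem inner_eq_of_isDrivenFlow (hT : 0 ≤ T) (hu : IntervalIntegrable u volume 0 T)
    (hM : ∀ x y, ⟪M x, y⟫_ℂ = ⟪x, M y⟫_ℂ)
    (hg : ContinuousOn g (Icc 0 T)) (hκ : ContinuousOn κ (Icc 0 T))
    (hψ : ContinuousOn ψ (Icc 0 T)) (fg : IsDrivenFlow b lam M u T g κ)
    (fψ : IsDrivenFlow b lam M u T ψ fun _ => 0) {t : ℝ} (ht : t ∈ Icc 0 T) :
    ⟪g t, ψ t⟫_ℂ = ⟪g 0, ψ 0⟫_ℂ + ∫ τ in (0 : ℝ)..t, ⟪κ τ, ψ τ⟫_ℂ := by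
  set F : ℕ → ℝ → ℂ := fun n τ => ⟪g τ, b n⟫_ℂ * ⟪b n, (Complex.I * u τ) • M (ψ τ)⟫_ℂ
      + ⟪(Complex.I * u τ) • M (g τ) + κ τ, b n⟫_ℂ * ⟪b n, ψ τ⟫_ℂ with hF
  have hFi : ∀ n, IntervalIntegrable (F n) volume 0 t := fun n =>
    (inner_coeff_of_isDrivenFlow hT hu hg hκ hψ fg fψ n).1.mono_set (by
      rw [uIcc_of_le hT, uIcc_of_le ht.1]; exact Icc_subset_Icc_right ht.2)
  have hFeq := fun n => (inner_coeff_of_isDrivenFlow hT hu hg hκ hψ fg fψ n).2 t ht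
  have hlim1 : Tendsto (fun N => ∑ n ∈ Finset.range N, ⟪g t, b n⟫_ℂ * ⟪b n, ψ t⟫_ℂ) atTop
      (𝓝 ⟪g t, ψ t⟫_ℂ) := (b.hasSum_inner_mul_inner (g t) (ψ t)).tendsto_sum_nat
  have hlim2 : Tendsto (fun N => ∑ n ∈ Finset.range N, ⟪g 0, b n⟫_ℂ * ⟪b n, ψ 0⟫_ℂ) atTop
      (𝓝 ⟪g 0, ψ 0⟫_ℂ) := (b.hasSum_inner_mul_inner (g 0) (ψ 0)).tendsto_sum_nat
  have hlim3 : Tendsto (fun N => ∫ τ in (0 : ℝ)..t, ∑ n ∈ Finset.range N, F n τ) atTop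
      (𝓝 (∫ τ in (0 : ℝ)..t, ⟪κ τ, ψ τ⟫_ℂ)) := by
    have hsubt : Icc 0 t ⊆ Icc 0 T := Icc_subset_Icc_right ht.2
    refine intervalIntegral.tendsto_integral_filter_of_dominated_convergence
      (fun τ => (‖g τ‖ * ‖M (ψ τ)‖ + ‖M (g τ)‖ * ‖ψ τ‖) * |u τ| + ‖κ τ‖ * ‖ψ τ‖) ?_ ?_ ?_ ?_
    · refine Eventually.of_forall fun N => ?_
      have : IntervalIntegrable (fun τ => ∑ n ∈ Finset.range N, F n τ) volume 0 t := by
        have := IntervalIntegrable.sum (Finset.range N) (fun n _ => hFi n)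
        refine this.congr fun τ _ => by simp
      exact this.aestronglyMeasurable_restrict_uIoc
    · refine Eventually.of_forall fun N => ae_of_all _ fun τ _ => ?_
      rw [hF]
      simp only [Finset.sum_add_distrib]
      have hI : ∀ v : H, ‖(Complex.I * u τ) • v‖ = |u τ| * ‖v‖ := by
        intro v
        rw [norm_smul, norm_mul, Complex.norm_I, one_mul, Complex.norm_real, Real.norm_eq_abs]
      calc _ ≤ ‖g τ‖ * ‖(Complex.I * u τ) • M (ψ τ)‖
            + ‖(Complex.I * u τ) • M (g τ) + κ τ‖ * ‖ψ τ‖ :=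
            norm_add_le_of_le (norm_sum_inner_mul_inner_le b _ _ _)
              (norm_sum_inner_mul_inner_le b _ _ _)
        _ ≤ ‖g τ‖ * ‖(Complex.I * u τ) • M (ψ τ)‖
            + (‖(Complex.I * u τ) • M (g τ)‖ + ‖κ τ‖) * ‖ψ τ‖ := by
            gcongr; exact norm_add_le _ _
        _ = _ := by rw [hI, hI]; ring
    · have hMψ : ContinuousOn (fun τ => M (ψ τ)) (Icc 0 t) :=
        M.continuous.comp_continuousOn (hψ.mono hsubt)
      have hMg : ContinuousOn (fun τ => M (g τ)) (Icc 0 t) :=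
        M.continuous.comp_continuousOn (hg.mono hsubt)
      have hut : IntervalIntegrable u volume 0 t := hu.mono_set (by
        rw [uIcc_of_le hT, uIcc_of_le ht.1]; exact hsubt)
      refine (hut.norm.continuousOn_mul ?_).add (ContinuousOn.intervalIntegrable ?_)
      · rw [uIcc_of_le ht.1]
        exact ((hg.mono hsubt).norm.mul hMψ.norm).add (hMg.norm.mul (hψ.mono hsubt).norm)
      · rw [uIcc_of_le ht.1]
        exact (hκ.mono hsubt).norm.mul (hψ.mono hsubt).norm
    · refine ae_of_all _ fun τ _ => ?_
      have h1 := (b.hasSum_inner_mul_inner (g τ) ((Complex.I * u τ) • M (ψ τ))).tendsto_sum_nat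
      have h2 := (b.hasSum_inner_mul_inner ((Complex.I * u τ) • M (g τ) + κ τ)
        (ψ τ)).tendsto_sum_nat
      have h3 := h1.add h2
      rw [inner_add_left, inner_smul_left, inner_smul_right, hM] at h3
      simp only [map_mul, Complex.conj_I, Complex.conj_ofReal] at h3
      rw [show Complex.I * (u τ : ℂ) * ⟪g τ, M (ψ τ)⟫_ℂ
          + (-Complex.I * (u τ : ℂ) * ⟪g τ, M (ψ τ)⟫_ℂ + ⟪κ τ, ψ τ⟫_ℂ) = ⟪κ τ, ψ τ⟫_ℂ by ring]
        at h3
      simpa only [hF, Finset.sum_add_distrib] using h3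
  refine tendsto_nhds_unique hlim1 ?_
  refine (hlim2.add hlim3).congr fun N => ?_
  rw [intervalIntegral.integral_finsetSum fun n _ => hFi n, ← Finset.sum_add_distrib]
  exact Finset.sum_congr rfl fun n _ => (hFeq n).symm

theorem norm_eq_of_isDrivenFlow (hT : 0 ≤ T) (hu : IntervalIntegrable u volume 0 T)
    (hM : ∀ x y, ⟪M x, y⟫_ℂ = ⟪x, M y⟫_ℂ) (hψ : ContinuousOn ψ (Icc 0 T))
    (fψ : IsDrivenFlow b lam M u T ψ fun _ => 0) {t : ℝ} (ht : t ∈ Icc 0 T) : ‖ψ t‖ = ‖ψ 0‖ := by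
  have h := inner_eq_of_isDrivenFlow hT hu hM hψ (continuousOn_const (c := 0)) hψ fψ fψ ht
  simp only [inner_zero_left, intervalIntegral.integral_zero, add_zero,
    inner_self_eq_norm_sq_to_K] at h
  have h' : ‖ψ t‖ ^ 2 = ‖ψ 0‖ ^ 2 := by exact_mod_cast h
  exact (sq_eq_sq₀ (norm_nonneg _) (norm_nonneg _)).1 h'

/-- Cauchy–Schwarz, obtained by integrating the square of |s| minus its mean I / T. -/
theorem sq_integral_abs_le {s : ℝ → ℝ} (hT : 0 < T) (hs : ContinuousOn s (Icc 0 T)) :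
    (∫ t in (0 : ℝ)..T, |s t|) ^ 2 ≤ T * ∫ t in (0 : ℝ)..T, s t ^ 2 := by
  set I := ∫ t in (0 : ℝ)..T, |s t|
  have hs' : ContinuousOn s (uIcc 0 T) := by rwa [uIcc_of_le hT.le]
  have h1 : IntervalIntegrable (fun t => s t ^ 2) volume 0 T :=
    (hs'.pow 2).intervalIntegrable
  have h2 : IntervalIntegrable (fun t => 2 * (I / T) * |s t|) volume 0 T :=
    (hs'.abs.intervalIntegrable).const_mul _
  have h0 : 0 ≤ ∫ t in (0 : ℝ)..T, (s t ^ 2 - 2 * (I / T) * |s t| + (I / T) ^ 2) := by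
    refine intervalIntegral.integral_nonneg hT.le fun t _ => ?_
    nlinarith [sq_nonneg (|s t| - I / T), sq_abs (s t)]
  rw [intervalIntegral.integral_add (h1.sub h2) (by simp), intervalIntegral.integral_sub h1 h2,
    intervalIntegral.integral_const_mul, intervalIntegral.integral_const] at h0
  simp only [sub_zero, smul_eq_mul] at h0
  have h3 : T * (I / T) = I := by field_simp
  have h4 : 0 ≤ T * ((∫ t in (0 : ℝ)..T, s t ^ 2) - 2 * (I / T) * I + T * (I / T) ^ 2) :=
    mul_nonneg hT.le h0
  nlinarith [h3]

/-- If the source `κ` is orthogonal to `g` to first order in `s`, then the overlap of `g` and of the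
solution `ψ` is known to second order in `s`. -/
theorem norm_inner_sub_one_add_le (hT : 0 < T) (hu : IntervalIntegrable u volume 0 T)
    (hM : ∀ x y, ⟪M x, y⟫_ℂ = ⟪x, M y⟫_ℂ)
    (hg : ContinuousOn g (Icc 0 T)) (hκ : ContinuousOn κ (Icc 0 T))
    (hψ : ContinuousOn ψ (Icc 0 T)) (fg : IsDrivenFlow b lam M u T g κ)
    (fψ : IsDrivenFlow b lam M u T ψ fun _ => 0) {s : ℝ → ℝ} (hs : ContinuousOn s (Icc 0 T))
    {C d : ℝ} (hC : 0 ≤ C) (hκs : ∀ t ∈ Icc 0 T, ‖κ t‖ ≤ C * |s t|)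
    (hg1 : ∀ t ∈ Icc 0 T, ‖g t‖ = 1) (h0 : g 0 = ψ 0)
    (hκg : ∀ t ∈ Icc 0 T, ⟪κ t, g t⟫_ℂ = -(Complex.I * (d * s t ^ 2 : ℝ))) :
    ‖⟪g T, ψ T⟫_ℂ - 1 + Complex.I * (d * ∫ t in (0 : ℝ)..T, s t ^ 2 : ℝ)‖
      ≤ 2 * C ^ 2 * (T * ∫ t in (0 : ℝ)..T, s t ^ 2) := by
  have h0mem : (0 : ℝ) ∈ Icc 0 T := left_mem_Icc.2 hT.le
  have hψ1 : ∀ t ∈ Icc 0 T, ‖ψ t‖ = 1 := fun t ht => by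
    rw [norm_eq_of_isDrivenFlow hT.le hu hM hψ fψ ht, ← h0, hg1 0 h0mem]
  have hz : ContinuousOn (fun t => ψ t - g t) (Icc 0 T) := hψ.sub hg
  have hg0 : ⟪g 0, ψ 0⟫_ℂ = 1 := by
    rw [← h0, inner_self_eq_norm_sq_to_K, hg1 0 h0mem]; simp
  have hp : ∀ t ∈ Icc 0 T, ⟪g t, ψ t⟫_ℂ - 1 + Complex.I * (d * ∫ τ in (0 : ℝ)..t, s τ ^ 2 : ℝ)
      = ∫ τ in (0 : ℝ)..t, ⟪κ τ, ψ τ - g τ⟫_ℂ := by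
    intro t ht
    have hsub : Icc 0 t ⊆ Icc 0 T := Icc_subset_Icc_right ht.2
    rw [inner_eq_of_isDrivenFlow hT.le hu hM hg hκ hψ fg fψ ht, hg0]
    have hi : IntervalIntegrable (fun τ => ⟪κ τ, ψ τ⟫_ℂ) volume 0 t := by
      refine ContinuousOn.intervalIntegrable ?_
      rw [uIcc_of_le ht.1]; exact (hκ.inner hψ).mono hsub
    have hi2 : IntervalIntegrable (fun τ => ⟪κ τ, g τ⟫_ℂ) volume 0 t := by
      refine ContinuousOn.intervalIntegrable ?_
      rw [uIcc_of_le ht.1]; exact (hκ.inner hg).mono hsub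
    simp_rw [inner_sub_right]
    rw [intervalIntegral.integral_sub hi hi2]
    have : ∫ τ in (0 : ℝ)..t, ⟪κ τ, g τ⟫_ℂ
        = -(Complex.I * (d * ∫ τ in (0 : ℝ)..t, s τ ^ 2 : ℝ)) := by
      rw [← intervalIntegral.integral_const_mul, ← intervalIntegral.integral_ofReal,
        ← intervalIntegral.integral_const_mul, ← intervalIntegral.integral_neg]
      refine intervalIntegral.integral_congr fun τ hτ => ?_
      rw [uIcc_of_le ht.1] at hτ
      exact hκg τ (hsub hτ)
    rw [this]; ring
  -- The largest distance `Z` between `ψ` and `g` is bounded in terms of itself: the source is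
  -- O(|s|), so the remainder is at most C Z I, and `Z ^ 2` is controlled by this remainder.
  obtain ⟨t₁, ht₁, hmax⟩ := isCompact_Icc.exists_isMaxOn ⟨0, h0mem⟩ hz.norm
  set Z := ‖ψ t₁ - g t₁‖ with hZ
  have hZ0 : 0 ≤ Z := norm_nonneg _
  set I := ∫ t in (0 : ℝ)..T, |s t| with hI
  have hbound : ∀ t ∈ Icc 0 T, ‖∫ τ in (0 : ℝ)..t, ⟪κ τ, ψ τ - g τ⟫_ℂ‖ ≤ C * Z * I := by
    intro t ht
    have hsub : Icc 0 t ⊆ Icc 0 T := Icc_subset_Icc_right ht.2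
    have hsT : IntervalIntegrable (fun t => |s t|) volume 0 T := by
      refine ContinuousOn.intervalIntegrable ?_
      rw [uIcc_of_le hT.le]; exact hs.abs
    have hst : IntervalIntegrable (fun t => |s t|) volume 0 t := by
      refine ContinuousOn.intervalIntegrable ?_
      rw [uIcc_of_le ht.1]; exact hs.abs.mono hsub
    calc _ ≤ ∫ τ in (0 : ℝ)..t, C * Z * |s τ| := by
          refine intervalIntegral.norm_integral_le_of_norm_le ht.1 (ae_of_all _ fun τ hτ => ?_)
            (hst.const_mul _)
          have hτ' : τ ∈ Icc 0 T := hsub (Ioc_subset_Icc_self hτ)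
          calc _ ≤ ‖κ τ‖ * ‖ψ τ - g τ‖ := norm_inner_le_norm _ _
            _ ≤ (C * |s τ|) * Z := by
              gcongr
              · exact hκs τ hτ'
              · exact hmax hτ'
            _ = _ := by ring
      _ = C * Z * ∫ τ in (0 : ℝ)..t, |s τ| := intervalIntegral.integral_const_mul _ _
      _ ≤ C * Z * I := by
          gcongr
          exact intervalIntegral.integral_mono_interval le_rfl ht.1 ht.2
            (ae_of_all _ fun τ => abs_nonneg _) hsT
  -- Both states have norm 1, so `Z ^ 2` is 2 minus twice the real part of the overlap. The second
  -- order term i d ∫ s² is purely imaginary and does not contribute.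
  have hZle : Z ≤ 2 * C * I := by
    have h1 : Z ^ 2 = 2 - 2 * (⟪g t₁, ψ t₁⟫_ℂ).re := by
      rw [hZ, @norm_sub_sq ℂ, hψ1 t₁ ht₁, hg1 t₁ ht₁, ← inner_conj_symm]
      simp only [RCLike.conj_re]
      rw [show RCLike.re ⟪g t₁, ψ t₁⟫_ℂ = (⟪g t₁, ψ t₁⟫_ℂ).re from rfl]
      ring
    have h2 := congrArg Complex.re (hp t₁ ht₁)
    simp only [Complex.add_re, Complex.sub_re, Complex.one_re, Complex.mul_re, Complex.I_re,
      Complex.I_im, Complex.ofReal_im, zero_mul, mul_zero, sub_zero, add_zero] at h2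
    have h3 := (Complex.abs_re_le_norm _).trans (hbound t₁ ht₁)
    rw [← h2] at h3
    have h4 := (abs_le.1 h3).1
    have h5 : Z ^ 2 ≤ 2 * C * I * Z := by nlinarith
    rcases hZ0.eq_or_lt with h | h
    · have : 0 ≤ I := intervalIntegral.integral_nonneg hT.le fun _ _ => abs_nonneg _
      rw [← h]; positivity
    · exact le_of_mul_le_mul_right (by nlinarith) h
  have hI0 : 0 ≤ I := intervalIntegral.integral_nonneg hT.le fun _ _ => abs_nonneg _
  rw [hp T (right_mem_Icc.2 hT.le)]
  calc _ ≤ C * Z * I := hbound T (right_mem_Icc.2 hT.le)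
    _ ≤ C * (2 * C * I) * I := by gcongr
    _ = 2 * C ^ 2 * I ^ 2 := by ring
    _ ≤ _ := by gcongr; exact sq_integral_abs_le hT hs

end Abstract

/-! ### The free evolution and weak solutions -/

theorem inner_sineBasis (n : ℕ) (f : StateSpace) : ⟪sineBasis n, f⟫_ℂ = coeff (n + 1) f := by
  rw [sineBasis_apply, coeff]

theorem hasSum_norm_coeff_sq (f : StateSpace) :
    HasSum (fun n => ‖coeff (n + 1) f‖ ^ 2) (‖f‖ ^ 2) := by
  have h := sineBasis.hasSum_inner_mul_inner f f
  rw [inner_self_eq_norm_sq_to_K] at h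
  have h2 : ∀ n, ⟪f, sineBasis n⟫_ℂ * ⟪sineBasis n, f⟫_ℂ = ((‖coeff (n + 1) f‖ ^ 2 : ℝ) : ℂ) := by
    intro n
    rw [← inner_conj_symm, inner_sineBasis, mul_comm, Complex.mul_conj, Complex.normSq_eq_norm_sq]
  simp_rw [h2] at h
  rw [← Complex.hasSum_ofReal]
  simpa using h

theorem norm_le_hsNorm {s : ℕ} {f : StateSpace} (hf : MemHs s f) : ‖f‖ ≤ hsNorm s f := by
  refine Real.le_sqrt_of_sq_le ?_
  rw [← (hasSum_norm_coeff_sq f).tsum_eq]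
  refine (hasSum_norm_coeff_sq f).summable.tsum_le_tsum (fun n => ?_) hf
  rw [mul_pow]
  have : (1 : ℝ) ≤ (((n + 1 : ℕ) : ℝ) ^ s) ^ 2 :=
    one_le_pow₀ (one_le_pow₀ (by exact_mod_cast Nat.succ_pos n))
  nlinarith [sq_nonneg ‖coeff (n + 1) f‖]

theorem coeff_sub (k : ℕ) (f g : StateSpace) : coeff k (f - g) = coeff k f - coeff k g :=
  inner_sub_right _ _ _

theorem coeff_smul (k : ℕ) (c : ℂ) (f : StateSpace) : coeff k (c • f) = c * coeff k f :=
  inner_smul_right _ _ _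

theorem MemHs.sub {s : ℕ} {f g : StateSpace} (hf : MemHs s f) (hg : MemHs s g) :
    MemHs s (f - g) := by
  refine Summable.of_nonneg_of_le (fun n => sq_nonneg _) (fun n => ?_)
    ((hf.mul_left 2).add (hg.mul_left 2))
  rw [coeff_sub, ← mul_add]
  set a := (((n + 1 : ℕ) : ℝ) ^ s)
  have h := norm_sub_le (coeff (n + 1) f) (coeff (n + 1) g)
  have ha : 0 ≤ a := by positivity
  calc (a * ‖coeff (n + 1) f - coeff (n + 1) g‖) ^ 2
      ≤ (a * (‖coeff (n + 1) f‖ + ‖coeff (n + 1) g‖)) ^ 2 := by gcongr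
    _ ≤ _ := by nlinarith [sq_nonneg (a * ‖coeff (n + 1) f‖ - a * ‖coeff (n + 1) g‖)]

theorem ContinuousInHs.continuousOn {s : ℕ} {T : ℝ} {ψ : ℝ → StateSpace}
    (h : ContinuousInHs s T ψ) : ContinuousOn ψ (Icc 0 T) := by
  intro t ht
  rw [ContinuousWithinAt, tendsto_iff_norm_sub_tendsto_zero]
  refine squeeze_zero' (Eventually.of_forall fun r => norm_nonneg _) ?_ (h.2 t ht)
  filter_upwards [self_mem_nhdsWithin] with r hr
  exact norm_le_hsNorm ((h.1 r hr).sub (h.1 t ht))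

theorem norm_exp_neg_I_mul (a t : ℝ) : ‖Complex.exp (-(Complex.I * a * t))‖ = 1 := by
  have := norm_exp_I_mul (-(a * t))
  rw [← this]; congr 2; push_cast; ring

/-- The phases have modulus 1, so the coefficients stay square summable. Convergence has to be known
here, since a divergent `tsum` would take the default value 0. -/
theorem exists_repr_freeEvolution (t : ℝ) (f : StateSpace) :
    HasSum (fun k : ℕ => (Complex.exp (-(Complex.I * eigenvalue (k + 1) * t)) * coeff (k + 1) f) •
      eigenfunction (k + 1)) (freeEvolution t f) ∧
    ∀ n, coeff (n + 1) (freeEvolution t f) =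
      Complex.exp (-(Complex.I * eigenvalue (n + 1) * t)) * coeff (n + 1) f := by
  set v : ℕ → ℂ := fun k => Complex.exp (-(Complex.I * eigenvalue (k + 1) * t)) * coeff (k + 1) f
  have hv : Memℓp v 2 := by
    rw [memℓp_gen_iff (by norm_num)]
    refine (hasSum_norm_coeff_sq f).summable.congr fun n => ?_
    rw [norm_mul, norm_exp_neg_I_mul, one_mul]
    simp
  have h1 := sineBasis.hasSum_repr_symm ⟨v, hv⟩
  have h2 : HasSum (fun k : ℕ => v k • eigenfunction (k + 1)) (sineBasis.repr.symm ⟨v, hv⟩) := by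
    simpa only [sineBasis_apply] using h1
  have h3 : freeEvolution t f = sineBasis.repr.symm ⟨v, hv⟩ := h2.tsum_eq
  refine ⟨h3 ▸ h2, fun n => ?_⟩
  rw [h3, ← inner_sineBasis, ← HilbertBasis.repr_apply_apply, LinearIsometryEquiv.apply_symm_apply]

theorem coeff_freeEvolution (t : ℝ) (f : StateSpace) (n : ℕ) :
    coeff (n + 1) (freeEvolution t f) =
      Complex.exp (-(Complex.I * eigenvalue (n + 1) * t)) * coeff (n + 1) f :=
  (exists_repr_freeEvolution t f).2 n

theorem norm_freeEvolution (t : ℝ) (f : StateSpace) : ‖freeEvolution t f‖ = ‖f‖ := by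
  have h := hasSum_norm_coeff_sq (freeEvolution t f)
  simp_rw [coeff_freeEvolution, norm_mul, norm_exp_neg_I_mul, one_mul] at h
  exact (sq_eq_sq₀ (norm_nonneg _) (norm_nonneg _)).1 (h.unique (hasSum_norm_coeff_sq f))

theorem eq_of_coeff_eq {f g : StateSpace} (h : ∀ n, coeff (n + 1) f = coeff (n + 1) g) : f = g := by
  rw [← sub_eq_zero]
  refine eq_zero_of_coeff_eq_zero _ fun k hk => ?_
  obtain ⟨n, rfl⟩ : ∃ n, k = n + 1 := ⟨k - 1, by omega⟩
  rw [coeff_sub, h, sub_self]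

/-- Integrability is what allows the Duhamel integral to be exchanged with a coefficient.
Measurability comes from the partial sums of the free evolution, and the bound from the invariance
of the norm. -/
theorem intervalIntegrable_freeEvolution {T t : ℝ} (ht : t ∈ Icc 0 T) {u : ℝ → ℝ}
    (hu : IntervalIntegrable u volume 0 T) {w : ℝ → StateSpace} (hw : ContinuousOn w (Icc 0 T)) :
    IntervalIntegrable (fun τ => freeEvolution (t - τ) ((u τ : ℂ) • w τ)) volume 0 t := by
  have hsub : Icc 0 t ⊆ Icc 0 T := Icc_subset_Icc_right ht.2
  have hT : 0 ≤ T := ht.1.trans ht.2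
  have hut : IntervalIntegrable u volume 0 t := hu.mono_set (by
    rw [uIcc_of_le hT, uIcc_of_le ht.1]; exact hsub)
  have hut' : IntervalIntegrable (fun τ => (u τ : ℂ)) volume 0 t := ⟨hut.1.ofReal, hut.2.ofReal⟩
  have hwt : ContinuousOn w (uIcc 0 t) := by rw [uIcc_of_le ht.1]; exact hw.mono hsub
  have hbound : IntervalIntegrable (fun τ => ‖w τ‖ * ‖u τ‖) volume 0 t :=
    hut.norm.continuousOn_mul hwt.norm
  refine hbound.mono_fun ?_ (ae_of_all _ fun τ => ?_)
  · refine aestronglyMeasurable_of_tendsto_ae atTop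
      (f := fun N τ => ∑ k ∈ Finset.range N,
        (Complex.exp (-(Complex.I * eigenvalue (k + 1) * ((t - τ : ℝ) : ℂ))) *
          coeff (k + 1) ((u τ : ℂ) • w τ)) • eigenfunction (k + 1)) (fun N => ?_)
      (ae_of_all _ fun τ =>
        (exists_repr_freeEvolution (t - τ) ((u τ : ℂ) • w τ)).1.tendsto_sum_nat)
    refine Finset.aestronglyMeasurable_fun_sum _ fun k _ => ?_
    refine AEStronglyMeasurable.smul_const ?_ _
    have hc : ContinuousOn (fun τ => Complex.exp (-(Complex.I * eigenvalue (k + 1) *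
        ((t - τ : ℝ) : ℂ))) * coeff (k + 1) (w τ)) (uIcc 0 t) := by
      have : ContinuousOn (fun τ => coeff (k + 1) (w τ)) (uIcc 0 t) :=
        continuousOn_const.inner hwt
      fun_prop
    have hi := hut'.continuousOn_mul hc
    refine (hi.congr fun τ _ => ?_).aestronglyMeasurable_restrict_uIoc
    simp only [coeff_smul]; ring
  · simp only []
    rw [norm_freeEvolution, norm_smul, Complex.norm_real, norm_mul, norm_norm, norm_norm, mul_comm]

section WeakSolution

variable {μ M : ℝ → ℝ} {u : ℝ → ℝ} {T : ℝ} {ψ₀ : StateSpace} {ψ : ℝ → StateSpace}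

theorem IsWeakSolution.coeff_eq (hM : Continuous M) (hμ : μ =ᵐ[vol01] M)
    (hu : IntervalIntegrable u volume 0 T) (h : IsWeakSolution T μ u ψ₀ ψ) (n : ℕ) {t : ℝ}
    (ht : t ∈ Icc 0 T) :
    coeff (n + 1) (ψ t) = Complex.exp (-(Complex.I * eigenvalue (n + 1) * t)) * coeff (n + 1) ψ₀ +
      Complex.I * ∫ τ in (0 : ℝ)..t, Complex.exp (-(Complex.I * eigenvalue (n + 1) *
        ((t - τ : ℝ) : ℂ))) * (u τ * coeff (n + 1) (mulOp M hM (ψ τ))) := by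
  have hi := intervalIntegrable_freeEvolution (w := fun τ => mulOp M hM (ψ τ)) ht hu
    ((mulOp M hM).continuous.comp_continuousOn h.1.continuousOn)
  have h2 := congrArg (coeff (n + 1)) (h.2 t ht)
  simp_rw [dipoleMul_eq_mulOp hM hμ] at h2
  have hadd : ∀ f g : StateSpace, coeff (n + 1) (f + g) = coeff (n + 1) f + coeff (n + 1) g :=
    fun f g => inner_add_right _ _ _
  rw [hadd, coeff_freeEvolution, coeff_smul] at h2
  rw [h2]
  congr 2
  have h3 := (innerSL ℂ (eigenfunction (n + 1))).intervalIntegral_comp_comm hi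
  simp only [innerSL_apply_apply] at h3
  rw [coeff, ← h3]
  refine intervalIntegral.integral_congr fun τ _ => ?_
  change coeff (n + 1) (freeEvolution (t - τ) _) = _
  rw [coeff_freeEvolution, coeff_smul]

theorem IsWeakSolution.initial_eq (hT : 0 ≤ T) (hM : Continuous M) (hμ : μ =ᵐ[vol01] M)
    (hu : IntervalIntegrable u volume 0 T) (h : IsWeakSolution T μ u ψ₀ ψ) : ψ 0 = ψ₀ := by
  refine eq_of_coeff_eq fun n => ?_
  rw [h.coeff_eq hM hμ hu n (left_mem_Icc.2 hT)]
  simp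

theorem IsWeakSolution.isDrivenFlow (hT : 0 ≤ T) (hM : Continuous M) (hμ : μ =ᵐ[vol01] M)
    (hu : IntervalIntegrable u volume 0 T) (h : IsWeakSolution T μ u ψ₀ ψ) :
    IsDrivenFlow sineBasis (fun n => eigenvalue (n + 1)) (mulOp M hM) u T ψ fun _ => 0 := by
  intro n t ht
  simp only [inner_sineBasis, add_zero, coeff_smul]
  rw [h.initial_eq hT hM hμ hu, h.coeff_eq hM hμ hu n ht, mul_add, ← mul_assoc, ← Complex.exp_add]
  congr 1
  · rw [show Complex.I * ((eigenvalue (n + 1) * t : ℝ) : ℂ)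
      + -(Complex.I * eigenvalue (n + 1) * t) = 0 by push_cast; ring, Complex.exp_zero, one_mul]
  · rw [← intervalIntegral.integral_const_mul, ← intervalIntegral.integral_const_mul]
    refine intervalIntegral.integral_congr fun τ _ => ?_
    have : Complex.exp (Complex.I * ((eigenvalue (n + 1) * τ : ℝ) : ℂ))
        = Complex.exp (Complex.I * ((eigenvalue (n + 1) * t : ℝ) : ℂ)) *
          Complex.exp (-(Complex.I * eigenvalue (n + 1) * ((t - τ : ℝ) : ℂ))) := by
      rw [← Complex.exp_add]; congr 1; push_cast; ring
    simp only [this]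
    ring

end WeakSolution

/-! ### Sobolev functions on the interval -/

/-- The primitive from 0 vanishes to the left of the support of `χ`, and also to its right because
the total integral is zero. -/
theorem exists_primitive_of_integral_eq_zero {χ : ℝ → ℝ} (hχ : ContDiff ℝ ∞ χ)
    (hc : HasCompactSupport χ) (hs : tsupport χ ⊆ Ioo (0 : ℝ) 1)
    (h0 : ∫ x in (0 : ℝ)..1, χ x = 0) :
    ∃ θ : ℝ → ℝ, ContDiff ℝ ∞ θ ∧ HasCompactSupport θ ∧ tsupport θ ⊆ Ioo (0 : ℝ) 1 ∧
      ∀ x, deriv θ x = χ x := by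
  set θ : ℝ → ℝ := fun x => ∫ y in (0 : ℝ)..x, χ y with hθ
  have hd : ∀ x, HasDerivAt θ (χ x) x := fun x =>
    intervalIntegral.integral_hasDerivAt_right (hχ.continuous.intervalIntegrable _ _)
      (hχ.continuous.stronglyMeasurableAtFilter _ _) hχ.continuous.continuousAt
  have hderiv : deriv θ = χ := funext fun x => (hd x).deriv
  have hdiff : ContDiff ℝ ∞ θ := by
    rw [contDiff_infty_iff_deriv]
    exact ⟨fun x => (hd x).differentiableAt, hderiv ▸ hχ⟩
  obtain ⟨a, b, ha, hb, hab⟩ : ∃ a b : ℝ, 0 < a ∧ b < 1 ∧ tsupport χ ⊆ Icc a b := by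
    rcases (tsupport χ).eq_empty_or_nonempty with h | h
    · exact ⟨1 / 2, 1 / 2, by norm_num, by norm_num, by rw [h]; exact empty_subset _⟩
    · have hK : IsCompact (tsupport χ) := hc
      obtain ⟨a, ha, ha'⟩ := hK.exists_isLeast h
      obtain ⟨b, hb, hb'⟩ := hK.exists_isGreatest h
      exact ⟨a, b, (hs ha).1, (hs hb).2, fun x hx => ⟨ha' hx, hb' hx⟩⟩
  have hz : ∀ x, x ∉ Icc a b → χ x = 0 := fun x hx => image_eq_zero_of_notMem_tsupport
    fun h => hx (hab h)
  have hsupp : Function.support θ ⊆ Icc a b := by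
    intro x hx
    by_contra hxm
    refine hx ?_
    rw [mem_Icc, not_and_or, not_le, not_le] at hxm
    rcases hxm with h | h
    · refine intervalIntegral.integral_zero_ae (ae_of_all _ fun y hy => hz y fun hy' => ?_)
      rw [mem_uIoc] at hy
      rcases hy with hy | hy
      · linarith [hy'.1, hy.2]
      · linarith [hy'.1, hy.2]
    · have h1 : θ x = θ x - ∫ y in (0 : ℝ)..1, χ y := by rw [h0, sub_zero]
      rw [h1, hθ]
      simp only
      rw [intervalIntegral.integral_interval_sub_left (hχ.continuous.intervalIntegrable _ _)
        (hχ.continuous.intervalIntegrable _ _)]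
      refine intervalIntegral.integral_zero_ae (ae_of_all _ fun y hy => hz y fun hy' => ?_)
      rw [mem_uIoc] at hy
      rcases hy with hy | hy
      · linarith [hy'.2, hy.1]
      · linarith [hy'.2, hy.1]
  have hts : tsupport θ ⊆ Icc a b := closure_minimal hsupp isClosed_Icc
  exact ⟨θ, hdiff, HasCompactSupport.of_support_subset_isCompact isCompact_Icc hsupp,
    hts.trans fun x hx => ⟨ha.trans_le hx.1, hx.2.trans_lt hb⟩, fun x => (hd x).deriv⟩

theorem exists_testFunction_integral_eq_one : ∃ ρ : ℝ → ℝ, ContDiff ℝ ∞ ρ ∧ HasCompactSupport ρ ∧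
    tsupport ρ ⊆ Ioo (0 : ℝ) 1 ∧ ∫ x in (0 : ℝ)..1, ρ x = 1 := by
  let B : ContDiffBump (1 / 2 : ℝ) := ⟨1 / 8, 1 / 4, by norm_num, by norm_num⟩
  have hts : tsupport (B.normed volume) ⊆ Ioo (0 : ℝ) 1 := by
    rw [B.tsupport_normed_eq, Real.closedBall_eq_Icc]
    intro x hx
    constructor <;> norm_num at hx ⊢ <;> linarith [hx.1, hx.2]
  refine ⟨B.normed volume, B.contDiff_normed, B.hasCompactSupport_normed, hts, ?_⟩
  rw [intervalIntegral.integral_of_le zero_le_one, integral_Ioc_eq_integral_Ioo,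
    setIntegral_eq_integral_of_forall_compl_eq_zero, B.integral_normed]
  exact fun x hx => image_eq_zero_of_notMem_tsupport fun h => hx (hts h)

/-- A function with vanishing weak derivative is constant. -/
theorem ae_eq_const_of_integral_mul_deriv_eq_zero {h : ℝ → ℝ}
    (hh : IntervalIntegrable h volume 0 1)
    (H : ∀ χ : ℝ → ℝ, ContDiff ℝ ∞ χ → HasCompactSupport χ → tsupport χ ⊆ Ioo (0 : ℝ) 1 →
      ∫ x in (0 : ℝ)..1, h x * deriv χ x = 0) : ∃ c : ℝ, ∀ᵐ x ∂vol01, h x = c := by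
  obtain ⟨ρ, hρ, hρc, hρs, hρ1⟩ := exists_testFunction_integral_eq_one
  set c := ∫ x in (0 : ℝ)..1, h x * ρ x with hc
  refine ⟨c, ?_⟩
  have hIoo : IntegrableOn h (Ioo 0 1) :=
    (intervalIntegrable_iff_integrableOn_Ioo_of_le zero_le_one).1 hh
  have key := isOpen_Ioo.ae_eq_zero_of_integral_contDiff_smul_eq_zero (U := Ioo (0 : ℝ) 1)
    (f := fun x => h x - c) (μ := volume)
    ((hIoo.sub (integrableOn_const (by simp))).locallyIntegrableOn) ?_
  · have : ∀ᵐ x ∂vol01, h x - c = 0 := (ae_restrict_iff' measurableSet_Ioo).2 key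
    filter_upwards [this] with x hx using sub_eq_zero.1 hx
  intro χ hχ hχc hχs
  have hmul : ∀ f : ℝ → ℝ, Continuous f → IntervalIntegrable (fun x => h x * f x) volume 0 1 :=
    fun f hf => hh.mul_continuousOn hf.continuousOn
  -- The du Bois-Reymond argument: χ - Jρ has integral zero, so it is the derivative of a test
  -- function and `H` applies to it. This gives ∫ hχ = J ∫ hρ = ∫ cχ.
  set J := ∫ x in (0 : ℝ)..1, χ x with hJ
  have hsub : ContDiff ℝ ∞ fun x => χ x - J * ρ x := hχ.sub (contDiff_const.mul hρ)
  have hsupp : tsupport (fun x => χ x - J * ρ x) ⊆ tsupport χ ∪ tsupport ρ := by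
    refine closure_minimal (fun x hx => ?_)
      ((isClosed_tsupport _).union (isClosed_tsupport _))
    by_contra hn
    rw [mem_union, not_or] at hn
    exact hx (by simp [image_eq_zero_of_notMem_tsupport hn.1,
      image_eq_zero_of_notMem_tsupport hn.2])
  obtain ⟨θ, h1, h2, h3, h4⟩ := exists_primitive_of_integral_eq_zero hsub
    (HasCompactSupport.of_support_subset_isCompact (hχc.isCompact.union hρc.isCompact)
      ((subset_tsupport _).trans hsupp)) (hsupp.trans (union_subset hχs hρs)) (by
      rw [intervalIntegral.integral_sub (hχ.continuous.intervalIntegrable _ _)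
        ((hρ.continuous.intervalIntegrable _ _).const_mul J),
        intervalIntegral.integral_const_mul, hρ1, ← hJ]; ring)
  have h5 := H θ h1 h2 h3
  simp_rw [h4, mul_sub] at h5
  rw [intervalIntegral.integral_sub (hmul _ hχ.continuous)
    (hmul (fun x => J * ρ x) (continuous_const.mul hρ.continuous))] at h5
  have h6 : ∫ x in (0 : ℝ)..1, h x * (J * ρ x) = J * c := by
    rw [hc, ← intervalIntegral.integral_const_mul]
    refine intervalIntegral.integral_congr fun x _ => ?_
    ring
  have h7 : ∫ x in (0 : ℝ)..1, χ x • (h x - c) = 0 := by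
    have : ∀ x, χ x • (h x - c) = h x * χ x - c * χ x := fun x => by
      rw [smul_eq_mul]; ring
    simp_rw [this]
    rw [intervalIntegral.integral_sub (hmul _ hχ.continuous)
      ((hχ.continuous.intervalIntegrable _ _).const_mul c),
      intervalIntegral.integral_const_mul, ← hJ]
    linarith
  rw [← h7, intervalIntegral.integral_of_le zero_le_one, integral_Ioc_eq_integral_Ioo,
    setIntegral_eq_integral_of_forall_compl_eq_zero]
  intro x hx
  rw [image_eq_zero_of_notMem_tsupport fun h => hx (hχs h), zero_smul]

theorem intervalIntegrable_of_memLp {g : ℝ → ℝ} (hg : MemLp g 2 vol01) :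
    IntervalIntegrable g volume 0 1 := by
  rw [intervalIntegrable_iff_integrableOn_Ioo_of_le zero_le_one]
  have : Integrable g vol01 := hg.integrable (by norm_num)
  exact this

/-- A function whose weak derivative is `g` is a primitive of `g`. -/
theorem ae_eq_const_add_integral {f g : ℝ → ℝ} (hf : IntervalIntegrable f volume 0 1)
    (hg : IntervalIntegrable g volume 0 1)
    (H : ∀ χ : ℝ → ℝ, ContDiff ℝ ∞ χ → HasCompactSupport χ → tsupport χ ⊆ Ioo (0 : ℝ) 1 →
      ∫ x in (0 : ℝ)..1, f x * deriv χ x = -∫ x in (0 : ℝ)..1, g x * χ x) :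
    ∃ c : ℝ, ∀ᵐ x ∂vol01, f x = c + ∫ y in (0 : ℝ)..x, g y := by
  have hac := hg.absolutelyContinuousOnInterval_intervalIntegral (c := 0) left_mem_uIcc
  have hGc : IntervalIntegrable (fun x => ∫ y in (0 : ℝ)..x, g y) volume 0 1 :=
    hac.continuousOn.intervalIntegrable
  obtain ⟨c, hc⟩ := ae_eq_const_of_integral_mul_deriv_eq_zero (hf.sub hGc) (by
    intro χ h1 h2 h3
    have hdc : Continuous (deriv χ) := h1.continuous_deriv (by simp)
    simp_rw [sub_mul]
    rw [intervalIntegral.integral_sub (hf.mul_continuousOn hdc.continuousOn)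
      (hGc.mul_continuousOn hdc.continuousOn), H χ h1 h2 h3]
    have hacχ : AbsolutelyContinuousOnInterval χ 0 1 :=
      (h1.of_le (by simp)).contDiffOn.absolutelyContinuousOnInterval
    have hz : ∀ x, x ∉ Ioo (0 : ℝ) 1 → χ x = 0 := fun x hx =>
      image_eq_zero_of_notMem_tsupport fun h => hx (h3 h)
    rw [hac.integral_mul_deriv_eq_deriv_mul hacχ, hz 0 (by simp), hz 1 (by simp)]
    have : ∫ x in (0 : ℝ)..1, deriv (fun x => ∫ y in (0 : ℝ)..x, g y) x * χ x
        = ∫ x in (0 : ℝ)..1, g x * χ x := by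
      refine intervalIntegral.integral_congr_ae ?_
      filter_upwards [hg.ae_hasDerivAt_integral] with x hx hxm
      rw [(hx (uIoc_subset_uIcc hxm) 0 left_mem_uIcc).deriv]
    rw [this]; ring)
  refine ⟨c, ?_⟩
  filter_upwards [hc] with x hx
  linarith

theorem HasWeakDeriv.integral_eq {m : ℕ} {f g : ℝ → ℝ} (h : HasWeakDeriv m f g) {χ : ℝ → ℝ}
    (h1 : ContDiff ℝ ∞ χ) (h2 : HasCompactSupport χ) (h3 : tsupport χ ⊆ Ioo (0 : ℝ) 1) :
    ∫ x in (0 : ℝ)..1, f x * iteratedDeriv m χ x = (-1) ^ m * ∫ x in (0 : ℝ)..1, g x * χ x := by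
  simpa only [intervalIntegral.integral_of_le zero_le_one, integral_Ioc_eq_integral_Ioo]
    using h.2.2 χ h1 h2 h3

/-- If `g` and `h` are the weak derivatives of `f` of order `m` and `m + 1`, then `h` is the weak
derivative of `g`. -/
theorem HasWeakDeriv.integral_mul_deriv {m : ℕ} {f g h : ℝ → ℝ} (hg : HasWeakDeriv m f g)
    (hh : HasWeakDeriv (m + 1) f h) {χ : ℝ → ℝ}
    (h1 : ContDiff ℝ ∞ χ) (h2 : HasCompactSupport χ) (h3 : tsupport χ ⊆ Ioo (0 : ℝ) 1) :
    ∫ x in (0 : ℝ)..1, g x * deriv χ x = -∫ x in (0 : ℝ)..1, h x * χ x := by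
  have e1 := hh.integral_eq h1 h2 h3
  have e2 := hg.integral_eq (χ := deriv χ) ((contDiff_infty_iff_deriv.1 h1).2) h2.deriv
    ((tsupport_deriv_subset).trans h3)
  rw [iteratedDeriv_succ'] at e1
  rw [e1, pow_succ] at e2
  have : ((-1 : ℝ) ^ m) ≠ 0 := by positivity
  refine mul_left_cancel₀ this ?_
  linarith

theorem hasDerivAt_primitive {f : ℝ → ℝ} (hf : Continuous f) (c x : ℝ) :
    HasDerivAt (fun x => c + ∫ y in (0 : ℝ)..x, f y) (f x) x :=
  (intervalIntegral.integral_hasDerivAt_right (hf.intervalIntegrable _ _)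
    (hf.stronglyMeasurableAtFilter _ _) hf.continuousAt).const_add c

theorem ae_const_add_integral_congr {f g : ℝ → ℝ} (h : f =ᵐ[vol01] g) (c : ℝ) {x : ℝ}
    (hx : x ∈ Ioo (0 : ℝ) 1) :
    c + ∫ y in (0 : ℝ)..x, f y = c + ∫ y in (0 : ℝ)..x, g y := by
  congr 1
  refine intervalIntegral.integral_congr_ae ?_
  have : ∀ᵐ y, y ∈ Ioo (0 : ℝ) 1 → f y = g y := (ae_restrict_iff' measurableSet_Ioo).1 h
  filter_upwards [this] with y hy hym
  rw [uIoc_of_le hx.1.le] at hym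
  exact hy ⟨hym.1, hym.2.trans_lt hx.2⟩

/-- A function of `H³(0,1)` has a representative of class `C²`, and its weak derivative is the
classical one. -/
theorem MemSobolev.exists_representative {μ : ℝ → ℝ} (hμ : MemSobolev 3 μ) :
    ∃ M M₁ M₂ : ℝ → ℝ, (∀ x, HasDerivAt M (M₁ x) x) ∧ (∀ x, HasDerivAt M₁ (M₂ x) x) ∧
      Continuous M₂ ∧ μ =ᵐ[vol01] M ∧ weakDeriv μ =ᵐ[vol01] M₁ := by
  obtain ⟨g₁, m₁, w₁⟩ := hμ.2 1 le_rfl (by norm_num)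
  obtain ⟨g₂, m₂, w₂⟩ := hμ.2 2 (by norm_num) (by norm_num)
  obtain ⟨g₃, m₃, w₃⟩ := hμ.2 3 (by norm_num) le_rfl
  have i₀ := intervalIntegrable_of_memLp hμ.1
  have i₁ := intervalIntegrable_of_memLp m₁
  have i₂ := intervalIntegrable_of_memLp m₂
  have i₃ := intervalIntegrable_of_memLp m₃
  obtain ⟨c₂, e₂⟩ := ae_eq_const_add_integral i₂ i₃ fun χ h1 h2 h3 =>
    w₂.integral_mul_deriv w₃ h1 h2 h3
  obtain ⟨c₁, e₁⟩ := ae_eq_const_add_integral i₁ i₂ fun χ h1 h2 h3 =>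
    w₁.integral_mul_deriv w₂ h1 h2 h3
  obtain ⟨c₀, e₀⟩ := ae_eq_const_add_integral i₀ i₁ fun χ h1 h2 h3 => by
    simpa using w₁.integral_eq h1 h2 h3
  have hG : ContinuousOn (fun x => c₂ + ∫ y in (0 : ℝ)..x, g₃ y) (Icc 0 1) := by
    have := (i₃.absolutelyContinuousOnInterval_intervalIntegral (c := 0) left_mem_uIcc).continuousOn
    rw [uIcc_of_le zero_le_one] at this
    exact continuousOn_const.add this
  -- The extension by constants outside [0,1] makes `M₂` continuous on ℝ, so that the successive
  -- primitives `M₁` and `M` are differentiable everywhere, without one-sided derivatives at the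
  -- endpoints.
  set M₂ : ℝ → ℝ := IccExtend zero_le_one (domRestrict (Icc 0 1) fun x => c₂ + ∫ y in (0 : ℝ)..x, g₃ y)
    with hM₂
  have cM₂ : Continuous M₂ := hG.domRestrict.Icc_extend'
  have f₂ : g₂ =ᵐ[vol01] M₂ := by
    filter_upwards [e₂, ae_vol01_mem] with x hx hxm
    rw [hx, hM₂, IccExtend_of_mem _ _ (Ioo_subset_Icc_self hxm)]
    rfl
  set M₁ : ℝ → ℝ := fun x => c₁ + ∫ y in (0 : ℝ)..x, M₂ y with hM₁
  have dM₁ : ∀ x, HasDerivAt M₁ (M₂ x) x := hasDerivAt_primitive cM₂ c₁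
  have cM₁ : Continuous M₁ := continuous_iff_continuousAt.2 fun x => (dM₁ x).continuousAt
  have f₁ : g₁ =ᵐ[vol01] M₁ := by
    filter_upwards [e₁, ae_vol01_mem] with x hx hxm
    rw [hx, ae_const_add_integral_congr f₂ _ hxm]
  refine ⟨fun x => c₀ + ∫ y in (0 : ℝ)..x, M₁ y, M₁, M₂, hasDerivAt_primitive cM₁ c₀, dM₁, cM₂,
    ?_, ?_⟩
  · filter_upwards [e₀, ae_vol01_mem] with x hx hxm
    rw [hx, ae_const_add_integral_congr f₁ _ hxm]
  · have hex : ∃ g : ℝ → ℝ, HasWeakDeriv 1 μ g := ⟨g₁, w₁⟩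
    have hw : HasWeakDeriv 1 μ (weakDeriv μ) := by
      rw [weakDeriv, dif_pos hex]; exact hex.choose_spec
    refine EventuallyEq.trans ?_ f₁
    -- The function `weakDeriv μ` is an arbitrary choice among the weak derivatives; it agrees with
    -- `g₁` almost everywhere because both have the same integral against every test function.
    have key := isOpen_Ioo.ae_eq_zero_of_integral_contDiff_smul_eq_zero (U := Ioo (0 : ℝ) 1)
      (f := fun x => weakDeriv μ x - g₁ x) (μ := volume) (hw.2.1.sub w₁.2.1) ?_
    · have : ∀ᵐ x ∂vol01, weakDeriv μ x - g₁ x = 0 := (ae_restrict_iff' measurableSet_Ioo).2 key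
      filter_upwards [this] with x hx using sub_eq_zero.1 hx
    intro χ h1 h2 h3
    have e := (hw.2.2 χ h1 h2 h3).symm.trans (w₁.2.2 χ h1 h2 h3)
    -- The chosen weak derivative is so far only locally integrable, so integrability is obtained on
    -- the compact support of `χ`.
    have hint : ∀ g : ℝ → ℝ, LocallyIntegrableOn g (Ioo (0 : ℝ) 1) →
        IntegrableOn (fun x => g x * χ x) (Ioo 0 1) := by
      intro g hg
      have hK : IntegrableOn (fun x => g x * χ x) (tsupport χ) :=
        (hg.integrableOn_compact_subset h3 h2).mul_continuousOn h1.continuous.continuousOn h2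
      refine (integrableOn_iff_integrable_of_support_subset fun x hx => ?_).1 hK |>.integrableOn
      by_contra hn
      exact hx (by simp [image_eq_zero_of_notMem_tsupport hn])
    have hzero : ∫ x in Ioo (0 : ℝ) 1, χ x • (weakDeriv μ x - g₁ x) = 0 := by
      have : ∀ x, χ x • (weakDeriv μ x - g₁ x) = weakDeriv μ x * χ x - g₁ x * χ x := fun x => by
        rw [smul_eq_mul]; ring
      simp_rw [this]
      rw [integral_sub (hint _ hw.2.1) (hint _ w₁.2.1)]
      linarith
    rw [← hzero, setIntegral_eq_integral_of_forall_compl_eq_zero]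
    intro x hx
    rw [image_eq_zero_of_notMem_tsupport fun h => hx (h3 h), zero_smul]

/-! ### The gauge transformed eigenstates -/

theorem phaseMul_add {M : ℝ → ℝ} (hM : Continuous M) {f g : ℝ → ℂ} (hf : Continuous f)
    (hg : Continuous g) (σ : ℝ) :
    phaseMul M (fun x => f x + g x) σ = phaseMul M f σ + phaseMul M g σ := by
  simp only [phaseMul, mul_add]
  exact toL2_add (by fun_prop) (by fun_prop)

theorem phaseMul_smul {M : ℝ → ℝ} (hM : Continuous M) {f : ℝ → ℂ} (c : ℂ) (hf : Continuous f)
    (σ : ℝ) : phaseMul M (fun x => c * f x) σ = c • phaseMul M f σ := by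
  simp only [phaseMul, mul_left_comm _ c]
  exact toL2_smul c (by fun_prop)

theorem mulOp_phaseMul {M : ℝ → ℝ} (hM : Continuous M) {f : ℝ → ℂ} (hf : Continuous f) (σ : ℝ) :
    mulOp M hM (phaseMul M f σ) = phaseMul M (fun x => M x * f x) σ := by
  rw [phaseMul, mulOp_toL2 hM (by fun_prop), phaseMul]
  simp only [mul_left_comm]

theorem phaseMul_zero {M : ℝ → ℝ} (f : ℝ → ℂ) : phaseMul M f 0 = toL2 f := by
  simp [phaseMul]

/-- The function `M''φ_k + 2M'φ_k'`. -/
noncomputable def commFun (M₁ M₂ : ℝ → ℝ) (k : ℕ) (x : ℝ) : ℝ :=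
  M₂ x * sineFun k x + 2 * M₁ x * (Real.sqrt 2 * (Real.cos (k * Real.pi * x) * (k * Real.pi)))

/-- The function `(M')²φ_k`. -/
noncomputable def sqFun (M₁ : ℝ → ℝ) (k : ℕ) (x : ℝ) : ℝ := M₁ x ^ 2 * sineFun k x

/-- The state `e^{iσM} Φ_k(t)`. -/
noncomputable def gaugeState (M : ℝ → ℝ) (k : ℕ) (σ : ℝ) (t : ℝ) : StateSpace :=
  Complex.exp (-(Complex.I * eigenvalue k * t)) • phaseMul M (fun x => (sineFun k x : ℂ)) σ

/-- The source term `e^{iσM} (σ (M''φ_k + 2M'φ_k') + iσ² (M')²φ_k)`, with the phase of `Φ_k(t)`. -/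
noncomputable def gaugeSource (M M₁ M₂ : ℝ → ℝ) (k : ℕ) (σ : ℝ) (t : ℝ) : StateSpace :=
  Complex.exp (-(Complex.I * eigenvalue k * t)) •
    ((σ : ℂ) • phaseMul M (fun x => (commFun M₁ M₂ k x : ℂ)) σ +
      (Complex.I * σ ^ 2) • phaseMul M (fun x => (sqFun M₁ k x : ℂ)) σ)

section Gauge

variable {M M₁ M₂ : ℝ → ℝ} (h₁ : ∀ x, HasDerivAt M (M₁ x) x) (h₂ : ∀ x, HasDerivAt M₁ (M₂ x) x)
  (hc : Continuous M₂)

theorem continuous_of_forall_hasDerivAt {f f' : ℝ → ℝ} (h : ∀ x, HasDerivAt f (f' x) x) :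
    Continuous f :=
  continuous_iff_continuousAt.2 fun x => (h x).continuousAt

theorem continuous_sineFun_ofReal (k : ℕ) : Continuous fun x => (sineFun k x : ℂ) :=
  Complex.continuous_ofReal.comp (continuous_sineFun k)

include h₂ hc in
theorem continuous_commFun (k : ℕ) : Continuous fun x => (commFun M₁ M₂ k x : ℂ) := by
  have := continuous_of_forall_hasDerivAt h₂
  have := continuous_sineFun k
  unfold commFun
  fun_prop

include h₂ in
theorem continuous_sqFun (k : ℕ) : Continuous fun x => (sqFun M₁ k x : ℂ) := by
  have := continuous_of_forall_hasDerivAt h₂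
  have := continuous_sineFun k
  unfold sqFun
  fun_prop

include h₁ h₂ hc in
-- The function e^{iσM}φ_k is C² and vanishes at 0 and 1, so A can be moved onto it. Expanding its
-- second derivative produces (M')²φ_k at order σ², M''φ_k + 2M'φ_k' at order σ, and the eigenvalue
-- of φ_k at order 0.
theorem eigenvalue_mul_inner_phaseMul (n k : ℕ) (σ : ℝ) :
    (eigenvalue n : ℂ) * ⟪eigenfunction n, phaseMul M (fun x => (sineFun k x : ℂ)) σ⟫_ℂ
      = σ ^ 2 * ⟪eigenfunction n, phaseMul M (fun x => (sqFun M₁ k x : ℂ)) σ⟫_ℂ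
        - Complex.I * σ * ⟪eigenfunction n, phaseMul M (fun x => (commFun M₁ M₂ k x : ℂ)) σ⟫_ℂ
        + eigenvalue k * ⟪eigenfunction n, phaseMul M (fun x => (sineFun k x : ℂ)) σ⟫_ℂ := by
  have cM := continuous_of_forall_hasDerivAt h₁
  have cM₁ := continuous_of_forall_hasDerivAt h₂
  have cs := continuous_sineFun_ofReal k
  have cW := continuous_commFun h₂ hc k
  have cD := continuous_sqFun h₂ k
  set φ' : ℝ → ℝ := fun x => Real.sqrt 2 * (Real.cos (k * Real.pi * x) * (k * Real.pi)) with hφ'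
  have hexp : ∀ x, HasDerivAt (fun x => Complex.exp (Complex.I * (σ * M x : ℝ)))
      (Complex.exp (Complex.I * (σ * M x : ℝ)) * (Complex.I * (σ * M₁ x : ℝ))) x := fun x =>
    ((((h₁ x).const_mul σ).ofReal_comp).const_mul Complex.I).cexp
  have e1 : ∀ x, HasDerivAt (fun x => Complex.exp (Complex.I * (σ * M x : ℝ)) * (sineFun k x : ℂ))
      (Complex.exp (Complex.I * (σ * M x : ℝ)) * ((Complex.I * (σ * M₁ x : ℝ)) * (sineFun k x : ℂ)
        + (φ' x : ℂ))) x := fun x => by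
    refine ((hexp x).mul (hasDerivAt_sineFun k x).ofReal_comp).congr_deriv ?_
    ring
  have e2 : ∀ x, HasDerivAt (fun x => Complex.exp (Complex.I * (σ * M x : ℝ)) *
      ((Complex.I * (σ * M₁ x : ℝ)) * (sineFun k x : ℂ) + (φ' x : ℂ)))
      (Complex.exp (Complex.I * (σ * M x : ℝ)) * ((-(σ ^ 2 : ℂ)) * (sqFun M₁ k x : ℂ) +
        (Complex.I * σ) * (commFun M₁ M₂ k x : ℂ)) +
        Complex.exp (Complex.I * (σ * M x : ℝ)) * ((-(eigenvalue k : ℂ)) * (sineFun k x : ℂ))) x :=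
    fun x => by
    have d1 : HasDerivAt (fun x => Complex.I * ((σ * M₁ x : ℝ) : ℂ))
      (Complex.I * ((σ * M₂ x : ℝ) : ℂ)) x :=
      (((h₂ x).const_mul σ).ofReal_comp).const_mul Complex.I
    refine ((hexp x).mul ((d1.mul (hasDerivAt_sineFun k x).ofReal_comp).add
      (hasDerivAt_deriv_sineFun k x).ofReal_comp)).congr_deriv ?_
    simp only [sqFun, commFun, Pi.add_apply, Pi.mul_apply]
    push_cast
    linear_combination (Complex.exp (Complex.I * (σ * M x)) * σ ^ 2 * M₁ x ^ 2 * sineFun k x)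
      * Complex.I_sq
  have key := eigenvalue_mul_inner_toL2 n e1 e2 (by fun_prop) (by simp [sineFun_zero_right])
    (by simp [sineFun_one_right])
  have e3 : toL2 (fun x => Complex.exp (Complex.I * (σ * M x : ℝ)) *
        ((-(σ ^ 2 : ℂ)) * (sqFun M₁ k x : ℂ) + (Complex.I * σ) * (commFun M₁ M₂ k x : ℂ)) +
        Complex.exp (Complex.I * (σ * M x : ℝ)) * ((-(eigenvalue k : ℂ)) * (sineFun k x : ℂ)))
      = (-(σ ^ 2 : ℂ)) • phaseMul M (fun x => (sqFun M₁ k x : ℂ)) σ +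
        (Complex.I * σ) • phaseMul M (fun x => (commFun M₁ M₂ k x : ℂ)) σ +
        (-(eigenvalue k : ℂ)) • phaseMul M (fun x => (sineFun k x : ℂ)) σ := by
    rw [toL2_add (by fun_prop) (by fun_prop), ← phaseMul_smul cM _ cD, ← phaseMul_smul cM _ cW,
      ← phaseMul_smul cM _ cs, ← phaseMul_add cM (by fun_prop) (by fun_prop)]
    rfl
  rw [e3, inner_add_right, inner_add_right, inner_smul_right, inner_smul_right,
    inner_smul_right] at key
  rw [phaseMul, key]
  simp only [phaseMul]
  ring

variable {u : ℝ → ℝ} {T : ℝ}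

theorem continuousOn_primitive (hT : 0 ≤ T) (hu : IntervalIntegrable u volume 0 T) :
    ContinuousOn (fun t => ∫ τ in (0 : ℝ)..t, u τ) (Icc 0 T) := by
  have := (hu.absolutelyContinuousOnInterval_intervalIntegral (c := 0) left_mem_uIcc).continuousOn
  rwa [uIcc_of_le hT] at this

theorem continuousOn_phaseMul (hM : Continuous M) {f : ℝ → ℂ} (hf : Continuous f) {s : ℝ → ℝ}
    {S : Set ℝ} (hs : ContinuousOn s S) : ContinuousOn (fun t => phaseMul M f (s t)) S :=
  (exists_lipschitzWith_phaseMul hM hf).choose_spec.continuous.comp_continuousOn hs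

include h₁ in
theorem continuousOn_gaugeState (k : ℕ) {s : ℝ → ℝ} {S : Set ℝ} (hs : ContinuousOn s S) :
    ContinuousOn (fun t => gaugeState M k (s t) t) S := by
  have := continuousOn_phaseMul (continuous_of_forall_hasDerivAt h₁) (continuous_sineFun_ofReal k) hs
  unfold gaugeState
  fun_prop

include h₁ h₂ hc in
theorem continuousOn_gaugeSource (k : ℕ) {s : ℝ → ℝ} {S : Set ℝ} (hs : ContinuousOn s S) :
    ContinuousOn (fun t => gaugeSource M M₁ M₂ k (s t) t) S := by
  have cM := continuous_of_forall_hasDerivAt h₁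
  have := continuousOn_phaseMul cM (continuous_commFun h₂ hc k) hs
  have := continuousOn_phaseMul cM (continuous_sqFun h₂ k) hs
  unfold gaugeSource
  fun_prop

include h₂ hc in
-- Differentiating the phase e^{isM} in time produces exactly the control term iuMg. What remains is
-- the failure of e^{isM} to commute with A, which involves s but not u. Each coefficient is a
-- product of a smooth phase `E` and of the absolutely continuous function `G`, with the chain rule
-- valid at almost every time.
theorem isDrivenFlow_gaugeState (k : ℕ) (hT : 0 ≤ T) (hu : IntervalIntegrable u volume 0 T) :
    IsDrivenFlow sineBasis (fun n => eigenvalue (n + 1))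
      (mulOp M (continuous_of_forall_hasDerivAt h₁)) u T
      (fun t => gaugeState M k (∫ τ in (0 : ℝ)..t, u τ) t)
      (fun t => gaugeSource M M₁ M₂ k (∫ τ in (0 : ℝ)..t, u τ) t) := by
  intro n t ht
  have cM := continuous_of_forall_hasDerivAt h₁
  have cs := continuous_sineFun_ofReal k
  have hsC := continuousOn_primitive hT hu
  have hac := hu.absolutelyContinuousOnInterval_intervalIntegral (c := 0) left_mem_uIcc
  set s : ℝ → ℝ := fun t => ∫ τ in (0 : ℝ)..t, u τ with hs
  set E : ℝ → ℂ := fun t => Complex.exp (Complex.I * ((eigenvalue (n + 1) - eigenvalue k) * t : ℝ))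
    with hE
  set G : ℝ → ℂ := fun t => ⟪eigenfunction (n + 1), phaseMul M (fun x => (sineFun k x : ℂ)) (s t)⟫_ℂ
    with hG
  have hEE : ∀ t : ℝ, Complex.exp (Complex.I * (eigenvalue (n + 1) * t : ℝ)) *
      Complex.exp (-(Complex.I * eigenvalue k * t)) = E t := fun t => by
    rw [hE, ← Complex.exp_add]; congr 1; push_cast; ring
  have hF : ∀ t : ℝ, Complex.exp (Complex.I * (eigenvalue (n + 1) * t : ℝ)) *
      ⟪sineBasis n, gaugeState M k (s t) t⟫_ℂ = E t * G t := fun t => by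
    rw [sineBasis_apply, gaugeState, inner_smul_right, ← mul_assoc, hEE]
  have hGac : AbsolutelyContinuousOnInterval G 0 T := by
    obtain ⟨K, hK⟩ := exists_lipschitzWith_phaseMul cM cs
    exact absolutelyContinuousOnInterval_lipschitz_comp
      (innerSL ℂ (eigenfunction (n + 1))).lipschitz
      (absolutelyContinuousOnInterval_lipschitz_comp hK hac)
  have hdE : ∀ t : ℝ, HasDerivAt E
      (E t * (Complex.I * ((eigenvalue (n + 1) - eigenvalue k : ℝ) : ℂ))) t := fun t => by
    have h : HasDerivAt (fun t : ℝ => (eigenvalue (n + 1) - eigenvalue k) * t)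
      (eigenvalue (n + 1) - eigenvalue k) t := by
      simpa using (hasDerivAt_id t).const_mul (eigenvalue (n + 1) - eigenvalue k)
    exact ((h.ofReal_comp).const_mul Complex.I).cexp
  have hEac : AbsolutelyContinuousOnInterval E 0 T := by
    refine LipschitzOnWith.absolutelyContinuousOnInterval
      (K := ‖eigenvalue (n + 1) - eigenvalue k‖₊) (LipschitzWith.lipschitzOnWith ?_)
    refine LipschitzWith.of_dist_le_mul fun a b => ?_
    rw [dist_eq_norm]
    refine (norm_exp_sub_exp_le _ _).trans ?_
    rw [← mul_sub, abs_mul, Real.dist_eq, coe_nnnorm, Real.norm_eq_abs]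
  have hi := IsDrivenFlow.intervalIntegrable (b := sineBasis) (lam := fun n => eigenvalue (n + 1))
    (M := mulOp M cM) (u := u) hT hu (continuousOn_gaugeState h₁ k hsC)
    (continuousOn_gaugeSource h₁ h₂ hc k hsC) n
  have hfin := sub_eq_integral_of_absolutelyContinuous (hEac.smul hGac) hi (t := t) (by
    filter_upwards [hu.ae_hasDerivAt_integral] with r hr hrm
    have hds : HasDerivAt s (u r) r := hr hrm 0 left_mem_uIcc
    have hdP := (hasDerivAt_phaseMul cM cs (s r)).scomp r hds
    have hdG : HasDerivAt G ⟪eigenfunction (n + 1), u r •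
        phaseMul M (fun x => Complex.I * (M x * (sineFun k x : ℂ))) (s r)⟫_ℂ r :=
      ((innerSL ℂ (eigenfunction (n + 1))).restrictScalars ℝ).hasFDerivAt.comp_hasDerivAt r hdP
    refine ((hdE r).mul hdG).congr_deriv ?_
    have key := eigenvalue_mul_inner_phaseMul h₁ h₂ hc (n + 1) k (s r)
    have hsm : ∀ (c : ℝ) (v : StateSpace), c • v = (c : ℂ) • v := fun c v =>
      RCLike.real_smul_eq_coe_smul (K := ℂ) c v
    rw [sineBasis_apply, gaugeState, gaugeSource, map_smul, mulOp_phaseMul cM cs,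
      phaseMul_smul cM _ (by fun_prop), hsm]
    simp only [inner_smul_right, inner_add_right, hG]
    rw [← hEE r]
    push_cast
    linear_combination (Complex.I * Complex.exp (Complex.I * (eigenvalue (n + 1) * r)) *
      Complex.exp (-(Complex.I * eigenvalue k * r))) * key -
      (Complex.exp (Complex.I * (eigenvalue (n + 1) * r)) *
      Complex.exp (-(Complex.I * eigenvalue k * r)) * s r *
      ⟪eigenfunction (n + 1), phaseMul M (fun x => (commFun M₁ M₂ k x : ℂ)) (s r)⟫_ℂ) *
        Complex.I_sq) (by rwa [uIcc_of_le hT])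
  simp only [Pi.smul_apply', smul_eq_mul] at hfin
  have h0 := hF 0
  simp only [mul_zero, Complex.ofReal_zero, Complex.exp_zero, one_mul] at h0
  rw [h0, hF t]
  exact hfin

end Gauge

/-! ### Second order expansion of the overlap -/

section Overlap

variable {M M₁ M₂ : ℝ → ℝ} (h₁ : ∀ x, HasDerivAt M (M₁ x) x) (h₂ : ∀ x, HasDerivAt M₁ (M₂ x) x)
  (hc : Continuous M₂)

theorem inner_exp_smul_exp_smul (r : ℝ) (f g : StateSpace) :
    ⟪Complex.exp (-(Complex.I * r)) • f, Complex.exp (-(Complex.I * r)) • g⟫_ℂ = ⟪f, g⟫_ℂ := by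
  have h : starRingEnd ℂ (Complex.exp (-(Complex.I * r))) * Complex.exp (-(Complex.I * r)) = 1 := by
    rw [mul_comm, Complex.mul_conj, Complex.normSq_eq_norm_sq,
      show -(Complex.I * (r : ℂ)) = Complex.I * ((-r : ℝ) : ℂ) by push_cast; ring, norm_exp_I_mul]
    simp
  rw [inner_smul_left, inner_smul_right]
  linear_combination ⟪f, g⟫_ℂ * h

include h₁ in
theorem norm_gaugeState {k : ℕ} (hk : 1 ≤ k) (σ t : ℝ) : ‖gaugeState M k σ t‖ = 1 := by
  have h : ⟪gaugeState M k σ t, gaugeState M k σ t⟫_ℂ = 1 := by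
    rw [gaugeState, show Complex.I * (eigenvalue k : ℂ) * t
      = Complex.I * ((eigenvalue k * t : ℝ) : ℂ) by push_cast; ring, inner_exp_smul_exp_smul,
      inner_phaseMul (continuous_of_forall_hasDerivAt h₁) (continuous_sineFun_ofReal k)
        (continuous_sineFun_ofReal k)]
    simp only [Complex.conj_ofReal, ← Complex.ofReal_mul]
    rw [intervalIntegral.integral_ofReal, integral_sineFun_mul _ _ hk]
    simp
  rw [norm_eq_sqrt_re_inner (𝕜 := ℂ), h]
  simp

include h₂ hc in
-- The integrand is the derivative of M'φ_k², which vanishes at both ends. This removes the term of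
-- first order in s from the overlap and leaves the quadratic one.
theorem integral_commFun_mul_sineFun (k : ℕ) :
    ∫ x in (0 : ℝ)..1, commFun M₁ M₂ k x * sineFun k x = 0 := by
  have cM₁ := continuous_of_forall_hasDerivAt h₂
  have hd : ∀ x ∈ uIcc (0 : ℝ) 1, HasDerivAt (fun x => M₁ x * sineFun k x ^ 2)
      (commFun M₁ M₂ k x * sineFun k x) x := fun x _ => by
    refine ((h₂ x).mul ((hasDerivAt_sineFun k x).pow 2)).congr_deriv ?_
    simp only [commFun, Pi.pow_apply]
    push_cast
    ring
  rw [intervalIntegral.integral_eq_sub_of_hasDerivAt hd]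
  · simp [sineFun_zero_right, sineFun_one_right]
  · refine Continuous.intervalIntegrable ?_ _ _
    have := continuous_sineFun k
    unfold commFun
    fun_prop

include h₁ h₂ hc in
theorem inner_gaugeSource_gaugeState (k : ℕ) (σ t : ℝ) :
    ⟪gaugeSource M M₁ M₂ k σ t, gaugeState M k σ t⟫_ℂ
      = -(Complex.I * ((∫ x in (0 : ℝ)..1, M₁ x ^ 2 * sineFun k x * sineFun k x) * σ ^ 2 : ℝ)) := by
  have cM := continuous_of_forall_hasDerivAt h₁
  rw [gaugeSource, gaugeState, show Complex.I * (eigenvalue k : ℂ) * t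
      = Complex.I * ((eigenvalue k * t : ℝ) : ℂ) by push_cast; ring, inner_exp_smul_exp_smul,
    inner_add_left, inner_smul_left, inner_smul_left,
    inner_phaseMul cM (continuous_commFun h₂ hc k) (continuous_sineFun_ofReal k),
    inner_phaseMul cM (continuous_sqFun h₂ k) (continuous_sineFun_ofReal k)]
  simp only [Complex.conj_ofReal, ← Complex.ofReal_mul]
  rw [intervalIntegral.integral_ofReal, intervalIntegral.integral_ofReal,
    integral_commFun_mul_sineFun h₂ hc k]
  simp only [sqFun, map_mul, map_pow, Complex.conj_I, Complex.conj_ofReal]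
  push_cast
  ring

include h₁ h₂ hc in
-- The restriction |σ| ≤ 1 serves to bound the quadratic part of the source by a multiple of |σ|.
theorem exists_norm_gaugeSource_le (k : ℕ) : ∃ C : ℝ, 0 ≤ C ∧ ∀ σ t : ℝ, |σ| ≤ 1 →
    ‖gaugeSource M M₁ M₂ k σ t‖ ≤ C * |σ| := by
  have cM := continuous_of_forall_hasDerivAt h₁
  obtain ⟨A, hA0, hA⟩ := exists_norm_le_of_continuous (continuous_commFun h₂ hc k)
  obtain ⟨B, hB0, hB⟩ := exists_norm_le_of_continuous (continuous_sqFun h₂ k)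
  refine ⟨A + B, by positivity, fun σ t hσ => ?_⟩
  have hA' := norm_phaseMul_le cM (continuous_commFun h₂ hc k) hA0 hA σ
  have hB' := norm_phaseMul_le cM (continuous_sqFun h₂ k) hB0 hB σ
  rw [gaugeSource, norm_smul, norm_exp_neg_I_mul, one_mul]
  refine (norm_add_le _ _).trans ?_
  rw [norm_smul, norm_smul, norm_mul, Complex.norm_I, one_mul, norm_pow, Complex.norm_real,
    Real.norm_eq_abs]
  have h0 := abs_nonneg σ
  have h1 : |σ| ^ 2 ≤ |σ| := by nlinarith
  calc |σ| * ‖phaseMul M (fun x => (commFun M₁ M₂ k x : ℂ)) σ‖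
      + |σ| ^ 2 * ‖phaseMul M (fun x => (sqFun M₁ k x : ℂ)) σ‖ ≤ |σ| * A + |σ| * B := by gcongr
    _ = _ := by ring

/-- Taylor's bound covers |a| ≤ 1; beyond, the triangle inequality gives 2|a| ≤ 2a², whence the
constant 2. -/
theorem norm_exp_sub_one_sub_le (a : ℝ) :
    ‖Complex.exp (Complex.I * a) - 1 - Complex.I * a‖ ≤ 2 * a ^ 2 := by
  have hn : ‖Complex.I * (a : ℂ)‖ = |a| := by
    rw [norm_mul, Complex.norm_I, one_mul, Complex.norm_real, Real.norm_eq_abs]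
  rcases le_or_gt |a| 1 with h | h
  · have := Complex.norm_exp_sub_one_sub_id_le (x := Complex.I * a) (by rwa [hn])
    rw [hn, sq_abs] at this
    nlinarith [sq_nonneg a]
  · have h1 := norm_exp_sub_exp_le a 0
    simp only [Complex.ofReal_zero, mul_zero, Complex.exp_zero, sub_zero] at h1
    calc _ ≤ ‖Complex.exp (Complex.I * a) - 1‖ + ‖Complex.I * (a : ℂ)‖ := norm_sub_le _ _
      _ ≤ |a| + |a| := by rw [hn]; gcongr
      _ ≤ 2 * a ^ 2 := by nlinarith [sq_abs a]

/-- Expand the phase under the integral, with 1 = ∫ φ_k². The inner product conjugates its first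
argument, so the linear term carries a minus sign. -/
theorem exists_norm_inner_phaseMul_sub_le (hM : Continuous M) {k : ℕ} (hk : 1 ≤ k) :
    ∃ K : ℝ, 0 ≤ K ∧ ∀ σ : ℝ,
      ‖⟪phaseMul M (fun x => (sineFun k x : ℂ)) σ, eigenfunction k⟫_ℂ - 1 +
        Complex.I * (σ * ∫ x in (0 : ℝ)..1, M x * sineFun k x * sineFun k x : ℝ)‖ ≤ K * σ ^ 2 := by
  have cs := continuous_sineFun k
  obtain ⟨A, hA0, hA⟩ := exists_norm_le_of_continuous hM
  obtain ⟨B, hB0, hB⟩ := exists_norm_le_of_continuous cs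
  refine ⟨2 * A ^ 2 * B ^ 2, by positivity, fun σ => ?_⟩
  have e1 : ⟪phaseMul M (fun x => (sineFun k x : ℂ)) σ, eigenfunction k⟫_ℂ
      = ∫ x in (0 : ℝ)..1, Complex.exp (Complex.I * (-(σ * M x) : ℝ)) *
        ((sineFun k x * sineFun k x : ℝ) : ℂ) := by
    rw [phaseMul, eigenfunction_eq, inner_toL2 (by fun_prop) (by fun_prop)]
    refine intervalIntegral.integral_congr fun x _ => ?_
    simp only [map_mul, ← Complex.exp_conj, Complex.conj_I, Complex.conj_ofReal]
    push_cast
    ring_nf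
  have e2 : (1 : ℂ) = ∫ x in (0 : ℝ)..1, ((sineFun k x * sineFun k x : ℝ) : ℂ) := by
    rw [intervalIntegral.integral_ofReal, integral_sineFun_mul _ _ hk]
    simp
  have e3 : Complex.I * (σ * ∫ x in (0 : ℝ)..1, M x * sineFun k x * sineFun k x : ℝ)
      = ∫ x in (0 : ℝ)..1, Complex.I * ((σ * (M x * sineFun k x * sineFun k x) : ℝ) : ℂ) := by
    rw [intervalIntegral.integral_const_mul, intervalIntegral.integral_ofReal,
      intervalIntegral.integral_const_mul]
  rw [e1, e3, e2, ← intervalIntegral.integral_sub, ← intervalIntegral.integral_add]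
  · have := intervalIntegral.norm_integral_le_of_norm_le_const (a := 0) (b := 1)
      (C := 2 * A ^ 2 * B ^ 2 * σ ^ 2) (f := fun x : ℝ =>
        Complex.exp (Complex.I * (-(σ * M x) : ℝ)) * ((sineFun k x * sineFun k x : ℝ) : ℂ)
        - ((sineFun k x * sineFun k x : ℝ) : ℂ)
        + Complex.I * ((σ * (M x * sineFun k x * sineFun k x) : ℝ) : ℂ)) (fun x hx => by
        rw [uIoc_of_le zero_le_one] at hx
        have hA' := hA x (Ioc_subset_Icc_self hx)
        have hB' := hB x (Ioc_subset_Icc_self hx)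
        rw [show Complex.exp (Complex.I * (-(σ * M x) : ℝ)) * ((sineFun k x * sineFun k x : ℝ) : ℂ)
          - ((sineFun k x * sineFun k x : ℝ) : ℂ)
          + Complex.I * ((σ * (M x * sineFun k x * sineFun k x) : ℝ) : ℂ)
          = (Complex.exp (Complex.I * (-(σ * M x) : ℝ)) - 1 - Complex.I * (-(σ * M x) : ℝ))
            * ((sineFun k x * sineFun k x : ℝ) : ℂ) by push_cast; ring, norm_mul,
          Complex.norm_real, norm_mul]
        have h1 := norm_exp_sub_one_sub_le (-(σ * M x))
        have h2 : (-(σ * M x)) ^ 2 = σ ^ 2 * ‖M x‖ ^ 2 := by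
          rw [Real.norm_eq_abs, sq_abs]; ring
        rw [h2] at h1
        calc _ ≤ 2 * (σ ^ 2 * ‖M x‖ ^ 2) * (‖sineFun k x‖ * ‖sineFun k x‖) := by gcongr
          _ ≤ 2 * (σ ^ 2 * A ^ 2) * (B * B) := by gcongr
          _ = _ := by ring)
    simpa using this
  · exact Continuous.intervalIntegrable (by fun_prop) _ _
  · exact Continuous.intervalIntegrable (by fun_prop) _ _
  · exact Continuous.intervalIntegrable (by fun_prop) _ _
  · exact Continuous.intervalIntegrable (by fun_prop) _ _

include h₁ h₂ hc in
/-- If the solution starting from `φ_k` reaches a multiple `c Φ_k(T)`, then `c` is known to second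
order in the primitive of the control. -/
theorem exists_overlap_expansion {μ : ℝ → ℝ} (hμ : μ =ᵐ[vol01] M) {k : ℕ} (hk : 1 ≤ k) :
    ∃ K : ℝ, 0 ≤ K ∧ ∀ T : ℝ, 0 < T → ∀ u : ℝ → ℝ, IntervalIntegrable u volume 0 T →
      (∀ t ∈ Icc 0 T, |∫ τ in (0 : ℝ)..t, u τ| ≤ 1) → ∀ (ψ : ℝ → StateSpace) (c : ℂ),
      IsWeakSolution T μ u (eigenfunction k) ψ → ψ T = c • eigenstate k T →
      ∃ E : ℂ, ‖E - 1 + Complex.I * ((∫ τ in (0 : ℝ)..T, u τ) *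
          ∫ x in (0 : ℝ)..1, M x * sineFun k x * sineFun k x : ℝ)‖
            ≤ K * (∫ τ in (0 : ℝ)..T, u τ) ^ 2 ∧
        ‖c * E - 1 + Complex.I * ((∫ x in (0 : ℝ)..1, M₁ x ^ 2 * sineFun k x * sineFun k x) *
          ∫ t in (0 : ℝ)..T, (∫ τ in (0 : ℝ)..t, u τ) ^ 2 : ℝ)‖
            ≤ K * (T * ∫ t in (0 : ℝ)..T, (∫ τ in (0 : ℝ)..t, u τ) ^ 2) := by
  have cM := continuous_of_forall_hasDerivAt h₁
  obtain ⟨K, hK0, hK⟩ := exists_norm_inner_phaseMul_sub_le cM hk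
  obtain ⟨C, hC0, hC⟩ := exists_norm_gaugeSource_le h₁ h₂ hc k
  refine ⟨K + 2 * C ^ 2, by positivity, fun T hT u hu hs1 ψ c hψ hψT => ?_⟩
  have hsC := continuousOn_primitive hT.le hu
  have hest := norm_inner_sub_one_add_le hT hu (inner_mulOp_left cM)
    (continuousOn_gaugeState h₁ k hsC) (continuousOn_gaugeSource h₁ h₂ hc k hsC)
    hψ.1.continuousOn (isDrivenFlow_gaugeState h₁ h₂ hc k hT.le hu)
    (hψ.isDrivenFlow hT.le cM hμ hu) hsC hC0 (fun t ht => hC _ t (hs1 t ht))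
    (fun t _ => norm_gaugeState h₁ hk _ t)
    (by
      rw [hψ.initial_eq hT.le cM hμ hu, gaugeState, intervalIntegral.integral_same, phaseMul_zero,
        eigenfunction_eq]
      simp)
    (fun t _ => inner_gaugeSource_gaugeState h₁ h₂ hc k _ t)
  -- The gauge state and Φ_k(T) carry the same phase e^{-iλ_k T}, which cancels. The overlap is `c`
  -- times a number `E` that depends only on `M`, `k` and the final value of the primitive.
  have hov : ⟪gaugeState M k (∫ τ in (0 : ℝ)..T, u τ) T, ψ T⟫_ℂ
      = c * ⟪phaseMul M (fun x => (sineFun k x : ℂ)) (∫ τ in (0 : ℝ)..T, u τ),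
        eigenfunction k⟫_ℂ := by
    rw [hψT, inner_smul_right, gaugeState, eigenstate, show Complex.I * (eigenvalue k : ℂ) * T
      = Complex.I * ((eigenvalue k * T : ℝ) : ℂ) by push_cast; ring, inner_exp_smul_exp_smul]
  have hS : 0 ≤ ∫ t in (0 : ℝ)..T, (∫ τ in (0 : ℝ)..t, u τ) ^ 2 :=
    intervalIntegral.integral_nonneg hT.le fun t _ => sq_nonneg _
  refine ⟨_, (hK _).trans ?_, ?_⟩
  · nlinarith [mul_nonneg (sq_nonneg C) (sq_nonneg (∫ τ in (0 : ℝ)..T, u τ))]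
  · rw [← hov]
    refine hest.trans ?_
    nlinarith [mul_nonneg hK0 (mul_nonneg hT.le hS)]

end Overlap

/-! ### Comparison of three overlaps -/

theorem exists_pos_forall_mul_le {C D : ℝ} (hC : 0 ≤ C) (hD : 0 < D) :
    ∃ η : ℝ, 0 < η ∧ ∀ x, x ≤ η → C * x ≤ D := by
  refine ⟨D / (C + 1), by positivity, fun x hx => ?_⟩
  calc C * x ≤ C * (D / (C + 1)) := by gcongr
    _ ≤ (C + 1) * (D / (C + 1)) := by gcongr; linarith
    _ = D := by field_simp

/-- The first order terms add up, and the cross term (E - 1)(P - 1) is at most 2L|σ| · 2LS. -/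
theorem norm_mul_sub_one_add_le {L T σ S m d : ℝ} {E P : ℂ} (hL : 1 ≤ L) (hm : |m| ≤ L)
    (hd : |d| ≤ L) (hσ : |σ| ≤ 1) (hS : 0 ≤ S) (hT1 : T ≤ 1)
    (hE : ‖E - 1 + Complex.I * (σ * m : ℝ)‖ ≤ L * σ ^ 2)
    (hP : ‖P - 1 + Complex.I * (d * S : ℝ)‖ ≤ L * (T * S)) :
    ‖E * P - 1 + Complex.I * (σ * m + d * S : ℝ)‖
      ≤ L * σ ^ 2 + L * (T * S) + 4 * L ^ 2 * (|σ| * S) := by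
  have h0 := abs_nonneg σ
  have hnI : ∀ r : ℝ, ‖Complex.I * (r : ℂ)‖ = |r| := fun r => by
    rw [norm_mul, Complex.norm_I, one_mul, Complex.norm_real, Real.norm_eq_abs]
  have ha : ‖E - 1‖ ≤ 2 * L * |σ| := by
    calc ‖E - 1‖ = ‖(E - 1 + Complex.I * (σ * m : ℝ)) - Complex.I * (σ * m : ℝ)‖ := by
          rw [add_sub_cancel_right]
      _ ≤ L * σ ^ 2 + |σ * m| := (norm_sub_le _ _).trans (add_le_add hE (hnI _).le)
      _ ≤ L * |σ| + |σ| * L := by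
          rw [abs_mul, ← sq_abs]
          have : |σ| ^ 2 ≤ |σ| := by nlinarith
          gcongr
      _ = _ := by ring
  have hb : ‖P - 1‖ ≤ 2 * L * S := by
    calc ‖P - 1‖ = ‖(P - 1 + Complex.I * (d * S : ℝ)) - Complex.I * (d * S : ℝ)‖ := by
          rw [add_sub_cancel_right]
      _ ≤ L * (T * S) + |d * S| := (norm_sub_le _ _).trans (add_le_add hP (hnI _).le)
      _ ≤ L * (1 * S) + L * S := by
          rw [abs_mul, abs_of_nonneg hS]
          gcongr
      _ = _ := by ring
  have e : E * P - 1 + Complex.I * (σ * m + d * S : ℝ)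
      = (E - 1 + Complex.I * (σ * m : ℝ)) + (P - 1 + Complex.I * (d * S : ℝ))
        + (E - 1) * (P - 1) := by push_cast; ring
  rw [e]
  refine (norm_add_le _ _).trans (add_le_add ((norm_add_le _ _).trans (add_le_add hE hP)) ?_)
  rw [norm_mul]
  calc ‖E - 1‖ * ‖P - 1‖ ≤ (2 * L * |σ|) * (2 * L * S) := by gcongr
    _ = _ := by ring

theorem norm_sub_sub_le_of_norm_le {a b x y : ℂ} {r : ℝ} (ha : ‖a + x‖ ≤ r) (hb : ‖b + y‖ ≤ r) :
    ‖(a - b) + (x - y)‖ ≤ 2 * r := by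
  calc ‖(a - b) + (x - y)‖ = ‖(a + x) - (b + y)‖ := by congr 1; ring
    _ ≤ r + r := (norm_sub_le _ _).trans (add_le_add ha hb)
    _ = 2 * r := by ring

set_option maxHeartbeats 800000 in
/-- The overlaps of three solutions with a common phase `w` cannot have an additional phase `α` on
the third one, with imaginary part of sign `β`. -/
theorem exists_small_no_phase {mj mk ml dj dk dl K B β : ℝ} (hK : 0 ≤ K) (hm : mj ≠ mk)
    (hB : B = (ml - mk) * dj + (mj - ml) * dk + (mk - mj) * dl) (hB0 : B ≠ 0)
    (hβ : β = Real.sign (B * (mk - mj))) :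
    ∃ η : ℝ, 0 < η ∧ ∀ T σ S : ℝ, 0 ≤ T → T ≤ η → |σ| ≤ η → 0 ≤ S → S ≤ η →
      ∀ w α Ej Ek El : ℂ,
      ‖Ej - 1 + Complex.I * (σ * mj : ℝ)‖ ≤ K * σ ^ 2 →
      ‖Ek - 1 + Complex.I * (σ * mk : ℝ)‖ ≤ K * σ ^ 2 →
      ‖El - 1 + Complex.I * (σ * ml : ℝ)‖ ≤ K * σ ^ 2 →
      ‖w * Ej - 1 + Complex.I * (dj * S : ℝ)‖ ≤ K * (T * S) →
      ‖w * Ek - 1 + Complex.I * (dk * S : ℝ)‖ ≤ K * (T * S) →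
      ‖w * α * El - 1 + Complex.I * (dl * S : ℝ)‖ ≤ K * (T * S) →
      ∀ δ : ℝ, 0 < δ → α.im = β * δ → False := by
  set L : ℝ := 1 + K + |mj| + |mk| + |ml| + |dj| + |dk| + |dl| with hLdef
  have p1 := abs_nonneg mj
  have p2 := abs_nonneg mk
  have p3 := abs_nonneg ml
  have p4 := abs_nonneg dj
  have p5 := abs_nonneg dk
  have p6 := abs_nonneg dl
  have hL1 : 1 ≤ L := by rw [hLdef]; linarith
  have hKL : K ≤ L := by rw [hLdef]; linarith
  have hmj : |mj| ≤ L := by rw [hLdef]; linarith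
  have hmk : |mk| ≤ L := by rw [hLdef]; linarith
  have hml : |ml| ≤ L := by rw [hLdef]; linarith
  have hdj : |dj| ≤ L := by rw [hLdef]; linarith
  have hdk : |dk| ≤ L := by rw [hLdef]; linarith
  have hdl : |dl| ≤ L := by rw [hLdef]; linarith
  clear_value L
  set Δ := |mj - mk| with hΔ
  have hΔ0 : 0 < Δ := abs_pos.2 (sub_ne_zero.2 hm)
  -- The constants are those of the bounds below: |σ| ≤ A S, ρ ≤ A₂ η S, ‖X - 1‖ ≤ A₃ S, |θ| ≤ A₄ S,
  -- |βδ - θ| ≤ A₅ η S, and a total error A₆ η S in `hmain`.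
  set A := 8 * L / Δ with hA
  have hA0 : 0 ≤ A := by positivity
  set A₂ := L * A + L + 4 * L ^ 2 with hA₂
  have hA₂0 : 0 ≤ A₂ := by positivity
  set A₃ := A₂ + L * A + L with hA₃
  have hA₃0 : 0 ≤ A₃ := by positivity
  set A₄ := 2 * L * A + 2 * L with hA₄
  have hA₄0 : 0 ≤ A₄ := by positivity
  set A₅ := 2 * A₂ + 2 * (A₄ + 2 * A₂) * A₃ with hA₅
  have hA₅0 : 0 ≤ A₅ := by positivity
  set A₆ := Δ * A₅ + 4 * L * A₂ with hA₆
  have hA₆0 : 0 ≤ A₆ := by positivity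
  -- Three smallness conditions: the first absorbs the terms in σ of the error into |σ|Δ, the second
  -- gives ‖X - 1‖ ≤ 1/2, the third brings the final error down to |B| S.
  obtain ⟨η₁, q1, r1⟩ := exists_pos_forall_mul_le (C := 2 * L + 8 * L ^ 2) (D := Δ / 2)
    (by positivity) (by positivity)
  obtain ⟨η₂, q2, r2⟩ := exists_pos_forall_mul_le (C := A₃) (D := 1 / 2) hA₃0 (by norm_num)
  obtain ⟨η₃, q3, r3⟩ := exists_pos_forall_mul_le (C := A₆) (D := |B|) hA₆0 (abs_pos.2 hB0)
  obtain ⟨η, hη0, hη1, t1, t2, t3⟩ : ∃ η : ℝ, 0 < η ∧ η ≤ 1 ∧ (2 * L + 8 * L ^ 2) * η ≤ Δ / 2 ∧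
      A₃ * η ≤ 1 / 2 ∧ A₆ * η ≤ |B| :=
    ⟨min 1 (min η₁ (min η₂ η₃)), by positivity, min_le_left _ _,
      r1 _ ((min_le_right _ _).trans (min_le_left _ _)),
      r2 _ ((min_le_right _ _).trans ((min_le_right _ _).trans (min_le_left _ _))),
      r3 _ ((min_le_right _ _).trans ((min_le_right _ _).trans (min_le_right _ _)))⟩
  refine ⟨η, hη0, fun T σ S hT hTη hση hS hSη w α Ej Ek El ej ek el wj wk wl δ hδ hα => ?_⟩
  have hσ0 := abs_nonneg σ
  have hσ1 : |σ| ≤ 1 := hση.trans hη1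
  have up : ∀ {E : ℂ} {m : ℝ}, ‖E - 1 + Complex.I * (σ * m : ℝ)‖ ≤ K * σ ^ 2 →
      ‖E - 1 + Complex.I * (σ * m : ℝ)‖ ≤ L * σ ^ 2 := fun h => h.trans (by gcongr)
  have wp : ∀ {P : ℂ} {d : ℝ}, ‖P - 1 + Complex.I * (d * S : ℝ)‖ ≤ K * (T * S) →
      ‖P - 1 + Complex.I * (d * S : ℝ)‖ ≤ L * (T * S) := fun h => h.trans (by gcongr)
  set ρ := L * σ ^ 2 + L * (T * S) + 4 * L ^ 2 * (|σ| * S) with hρ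
  have hT1 := hTη.trans hη1
  -- Cross products eliminate the unknown phase without division: E_j(wE_k) = E_k(wE_j), and
  -- E_j(wαE_l) is α times E_l(wE_j).
  have Xjk := norm_mul_sub_one_add_le hL1 hmj hdk hσ1 hS hT1 (up ej) (wp wk)
  have Xkj := norm_mul_sub_one_add_le hL1 hmk hdj hσ1 hS hT1 (up ek) (wp wj)
  have Xlj := norm_mul_sub_one_add_le hL1 hml hdj hσ1 hS hT1 (up el) (wp wj)
  have Xjl := norm_mul_sub_one_add_le hL1 hmj hdl hσ1 hS hT1 (up ej) (wp wl)
  have hnI : ∀ r : ℝ, ‖Complex.I * (r : ℂ)‖ = |r| := fun r => by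
    rw [norm_mul, Complex.norm_I, one_mul, Complex.norm_real, Real.norm_eq_abs]
  have hbr : |σ * (mj - mk) + (dk - dj) * S| ≤ 2 * ρ := by
    have h := norm_sub_sub_le_of_norm_le Xjk Xkj
    rw [show Ej * (w * Ek) - 1 - (Ek * (w * Ej) - 1) +
        (Complex.I * ((σ * mj + dk * S : ℝ) : ℂ) - Complex.I * ((σ * mk + dj * S : ℝ) : ℂ))
        = Complex.I * ((σ * (mj - mk) + (dk - dj) * S : ℝ) : ℂ) by push_cast; ring, hnI] at h
    exact h
  -- This is where m_j ≠ m_k enters: the final value of the primitive is controlled by its squared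
  -- L² norm, so that ρ becomes an error of order ηS.
  have hσA : |σ| ≤ A * S := by
    have h1 : |σ| * Δ ≤ 2 * ρ + |dk - dj| * S := by
      calc |σ| * Δ = |(σ * (mj - mk) + (dk - dj) * S) - (dk - dj) * S| := by
            rw [add_sub_cancel_right, abs_mul]
        _ ≤ |σ * (mj - mk) + (dk - dj) * S| + |(dk - dj) * S| := abs_sub _ _
        _ ≤ _ := by rw [abs_mul (dk - dj), abs_of_nonneg hS]; gcongr
    have h2 : |dk - dj| ≤ 2 * L := (abs_sub _ _).trans (by linarith)
    have h3 : σ ^ 2 ≤ η * |σ| := by rw [← sq_abs, sq]; gcongr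
    have h4 : |σ| * S ≤ η * |σ| := by rw [mul_comm]; gcongr
    have h5 : T * S ≤ S := mul_le_of_le_one_left hS hT1
    have h6 : 2 * ρ ≤ (2 * L + 8 * L ^ 2) * η * |σ| + 2 * L * S := by
      have : ρ ≤ L * (η * |σ|) + L * S + 4 * L ^ 2 * (η * |σ|) := by rw [hρ]; gcongr
      linarith
    have h7 : (2 * L + 8 * L ^ 2) * η * |σ| ≤ Δ / 2 * |σ| := by gcongr
    have h8 : |dk - dj| * S ≤ 2 * L * S := by gcongr
    rw [hA, div_mul_eq_mul_div, le_div_iff₀ hΔ0]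
    linarith
  have hρA : ρ ≤ A₂ * (η * S) := by
    have h3 : σ ^ 2 ≤ A * (η * S) := by
      rw [← sq_abs]
      calc |σ| ^ 2 = |σ| * |σ| := sq _
        _ ≤ η * (A * S) := by gcongr
        _ = _ := by ring
    have h4 : |σ| * S ≤ η * S := by gcongr
    have h5 : T * S ≤ η * S := by gcongr
    calc ρ ≤ L * (A * (η * S)) + L * (η * S) + 4 * L ^ 2 * (η * S) := by rw [hρ]; gcongr
      _ = _ := by rw [hA₂]; ring
  have hρ0 : 0 ≤ ρ := (norm_nonneg _).trans Xjk
  set θ := σ * (ml - mj) + (dj - dl) * S with hθ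
  have hθA : |θ| ≤ A₄ * S := by
    have g1 : |ml - mj| ≤ 2 * L := (abs_sub _ _).trans (by linarith)
    have g2 : |dj - dl| ≤ 2 * L := (abs_sub _ _).trans (by linarith)
    calc |θ| ≤ |σ * (ml - mj)| + |(dj - dl) * S| := abs_add_le _ _
      _ = |σ| * |ml - mj| + |dj - dl| * S := by rw [abs_mul, abs_mul, abs_of_nonneg hS]
      _ ≤ (A * S) * (2 * L) + 2 * L * S := by gcongr
      _ = _ := by rw [hA₄]; ring
  set X := El * (w * Ej) with hX
  set Y := Ej * (w * α * El) with hY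
  have hαXY : α * X = Y := by rw [hX, hY]; ring
  have hYX : ‖Y - X - Complex.I * θ‖ ≤ 2 * ρ := by
    have h := norm_sub_sub_le_of_norm_le Xjl Xlj
    rw [show Y - 1 - (X - 1) +
        (Complex.I * ((σ * mj + dl * S : ℝ) : ℂ) - Complex.I * ((σ * ml + dj * S : ℝ) : ℂ))
        = Y - X - Complex.I * θ by rw [hθ]; push_cast; ring] at h
    exact h
  have hYX' : ‖Y - X‖ ≤ (A₄ + 2 * A₂) * S := by
    calc ‖Y - X‖ = ‖(Y - X - Complex.I * θ) + Complex.I * θ‖ := by rw [sub_add_cancel]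
      _ ≤ 2 * ρ + |θ| := (norm_add_le _ _).trans (add_le_add hYX (hnI _).le)
      _ ≤ 2 * (A₂ * (1 * S)) + A₄ * S := by
          have : A₂ * (η * S) ≤ A₂ * (1 * S) := by gcongr
          linarith
      _ = _ := by ring
  have hX1 : ‖X - 1‖ ≤ A₃ * S := by
    calc ‖X - 1‖ = ‖(X - 1 + Complex.I * (σ * ml + dj * S : ℝ)) -
          Complex.I * (σ * ml + dj * S : ℝ)‖ := by rw [add_sub_cancel_right]
      _ ≤ ρ + |σ * ml + dj * S| := (norm_sub_le _ _).trans (add_le_add Xlj (hnI _).le)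
      _ ≤ A₂ * (1 * S) + (A * S * L + L * S) := by
          refine add_le_add (hρA.trans (by gcongr)) ((abs_add_le _ _).trans ?_)
          rw [abs_mul, abs_mul, abs_of_nonneg hS]
          gcongr
      _ = _ := by rw [hA₃]; ring
  have hX2 : A₃ * S ≤ A₃ * η := by gcongr
  -- Since αX = Y with X close to 1, α - 1 is Y - X up to (α - 1)(X - 1), which is absorbed by ‖X -
  -- 1‖ ≤ 1/2.
  have hα1 : ‖α - 1‖ ≤ 2 * ((A₄ + 2 * A₂) * S) := by
    have h : α - 1 = (Y - X) - (α - 1) * (X - 1) := by rw [← hαXY]; ring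
    have h' : ‖α - 1‖ ≤ ‖Y - X‖ + ‖α - 1‖ * ‖X - 1‖ := by
      conv_lhs => rw [h]
      rw [← norm_mul]; exact norm_sub_le _ _
    have h'' : ‖α - 1‖ * ‖X - 1‖ ≤ ‖α - 1‖ * (1 / 2) := by
      gcongr; linarith
    linarith
  have hfin : |β * δ - θ| ≤ A₅ * (η * S) := by
    have h : α - 1 - Complex.I * θ = (Y - X - Complex.I * θ) - (α - 1) * (X - 1) := by
      rw [← hαXY]; ring
    have h1 : (α - 1 - Complex.I * θ).im = β * δ - θ := by simp [hα]
    rw [← h1]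
    refine (Complex.abs_im_le_norm _).trans ?_
    rw [h]
    calc _ ≤ 2 * ρ + ‖α - 1‖ * ‖X - 1‖ :=
          (norm_sub_le _ _).trans (add_le_add hYX (norm_mul _ _).le)
      _ ≤ 2 * (A₂ * (η * S)) + (2 * ((A₄ + 2 * A₂) * S)) * (A₃ * η) := by
          gcongr
          exact hX1.trans hX2
      _ = _ := by rw [hA₅]; ring
  -- Adding a multiple of the relation between j and k eliminates σ from θ; the remaining
  -- coefficient of S is exactly B.
  have hmain : |(mj - mk) * (β * δ) - S * B| ≤ |B| * S := by
    have g1 : |ml - mj| ≤ 2 * L := (abs_sub _ _).trans (by linarith)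
    have e : (mj - mk) * (β * δ) - S * B = (mj - mk) * (β * δ - θ)
        + (ml - mj) * (σ * (mj - mk) + (dk - dj) * S) := by rw [hB, hθ]; ring
    rw [e]
    calc _ ≤ Δ * |β * δ - θ| + |ml - mj| * |σ * (mj - mk) + (dk - dj) * S| := by
          refine (abs_add_le _ _).trans ?_
          rw [abs_mul, abs_mul]
      _ ≤ Δ * (A₅ * (η * S)) + 2 * L * (2 * (A₂ * (η * S))) := by
          gcongr
          exact hbr.trans (by linarith)
      _ = A₆ * η * S := by rw [hA₆]; ring
      _ ≤ |B| * S := by gcongr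
  have hmk0 : mk - mj ≠ 0 := sub_ne_zero.2 hm.symm
  -- By `hmain`, (m_j - m_k)βδ lies between 0 and 2SB, whereas by the choice of β it is nonzero and
  -- of sign opposite to B. The contradiction persists when S = 0.
  rcases lt_or_gt_of_ne hB0 with hBn | hBp
  · rw [abs_of_neg hBn] at hmain
    rcases lt_or_gt_of_ne hmk0 with hn | hp
    · rw [Real.sign_of_pos (mul_pos_of_neg_of_neg hBn hn)] at hβ
      subst hβ
      have := (abs_le.1 hmain).2
      linarith [mul_pos (neg_pos.2 hn) hδ]
    · rw [Real.sign_of_neg (mul_neg_of_neg_of_pos hBn hp)] at hβ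
      subst hβ
      have := (abs_le.1 hmain).2
      linarith [mul_pos hp hδ]
  · rw [abs_of_pos hBp] at hmain
    rcases lt_or_gt_of_ne hmk0 with hn | hp
    · rw [Real.sign_of_neg (mul_neg_of_pos_of_neg hBp hn)] at hβ
      subst hβ
      have := (abs_le.1 hmain).1
      linarith [mul_pos (neg_pos.2 hn) hδ]
    · rw [Real.sign_of_pos (mul_pos hBp hp)] at hβ
      subst hβ
      have := (abs_le.1 hmain).1
      linarith [mul_pos hp hδ]

/-! ### Controls and coefficients -/

/-- On an interval of length at most 1 the L¹ norm is bounded by the L² norm, and the L¹ norm bounds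
the primitive. -/
theorem abs_primitive_le_of_eLpNorm_lt {T ε : ℝ} (hT : 0 ≤ T) (hT1 : T ≤ 1) (hε : 0 ≤ ε) {u : ℝ → ℝ}
    (hu : MemLp u 2 (volume.restrict (Ioo 0 T)))
    (hn : eLpNorm u 2 (volume.restrict (Ioo 0 T)) < ENNReal.ofReal ε) :
    IntervalIntegrable u volume 0 T ∧ ∀ t ∈ Icc 0 T, |∫ τ in (0 : ℝ)..t, u τ| ≤ ε := by
  have hint : Integrable u (volume.restrict (Ioo 0 T)) := hu.integrable (by norm_num)
  have hi : IntervalIntegrable u volume 0 T :=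
    (intervalIntegrable_iff_integrableOn_Ioo_of_le hT).2 hint
  refine ⟨hi, fun t ht => ?_⟩
  have h1 : eLpNorm u 1 (volume.restrict (Ioo 0 T)) ≤ ENNReal.ofReal ε := by
    refine (eLpNorm_le_eLpNorm_mul_rpow_measure_univ (p := 1) (q := 2) (by norm_num) hu.1).trans ?_
    refine (mul_le_of_le_one_right zero_le ?_).trans hn.le
    refine ENNReal.rpow_le_one ?_ (by norm_num)
    rw [Measure.restrict_apply_univ, Real.volume_Ioo, sub_zero]
    exact ENNReal.ofReal_le_one.2 hT1
  have h2 : ∫ τ in (0 : ℝ)..T, ‖u τ‖ ≤ ε := by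
    rw [intervalIntegral.integral_of_le hT, integral_Ioc_eq_integral_Ioo,
      integral_norm_eq_lintegral_enorm hu.1, ← eLpNorm_one_eq_lintegral_enorm]
    exact ENNReal.toReal_le_of_le_ofReal hε h1
  rw [← Real.norm_eq_abs]
  calc ‖∫ τ in (0 : ℝ)..t, u τ‖ ≤ ∫ τ in (0 : ℝ)..t, ‖u τ‖ :=
        intervalIntegral.norm_integral_le_integral_norm ht.1
    _ ≤ ∫ τ in (0 : ℝ)..T, ‖u τ‖ := intervalIntegral.integral_mono_interval le_rfl ht.1 ht.2
        (ae_of_all _ fun τ => norm_nonneg _) hi.norm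
    _ ≤ ε := h2

theorem diagCoeff_congr {f g : ℝ → ℝ} (h : f =ᵐ[vol01] g) (k : ℕ) :
    diagCoeff f k = ∫ x in (0 : ℝ)..1, g x * sineFun k x * sineFun k x := by
  rw [← integral_vol01]
  refine integral_congr_ae ?_
  filter_upwards [h] with x hx
  rw [hx]

/-- The expression is antisymmetric in its three indices, so a permutation changes at most its sign.
-/
theorem calB_ne_zero_of_perm {μ : ℝ → ℝ} (hB : calB μ 1 2 3 ≠ 0) {j k l : ℕ}
    (hjkl : ({j, k, l} : Finset ℕ) = {1, 2, 3}) :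
    (1 ≤ j ∧ 1 ≤ k ∧ 1 ≤ l) ∧ calB μ j k l ≠ 0 := by
  have hj : j ∈ ({1, 2, 3} : Finset ℕ) := hjkl ▸ by simp
  have hk : k ∈ ({1, 2, 3} : Finset ℕ) := hjkl ▸ by simp
  have hl : l ∈ ({1, 2, 3} : Finset ℕ) := hjkl ▸ by simp
  simp only [Finset.mem_insert, Finset.mem_singleton] at hj hk hl
  refine ⟨by omega, fun h => hB ?_⟩
  unfold calB at h ⊢
  rcases hj with rfl | rfl | rfl <;> rcases hk with rfl | rfl | rfl <;>
    rcases hl with rfl | rfl | rfl <;>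
    first
    | exact absurd hjkl (by decide)
    | linear_combination h
    | linear_combination -h

end BilinearSchrodinger

theorem theorem4 (μ : ℝ → ℝ) (hμ : BilinearSchrodinger.MemSobolev 3 μ)
    (hB : BilinearSchrodinger.calB μ 1 2 3 ≠ 0)
    (j k l : ℕ) (hjkl : ({j, k, l} : Finset ℕ) = {1, 2, 3})
    (hjk : BilinearSchrodinger.diagCoeff μ j ≠ BilinearSchrodinger.diagCoeff μ k)
    (β : ℝ)
    (hβ : β = Real.sign (BilinearSchrodinger.calB μ j k l *
      (BilinearSchrodinger.diagCoeff μ k - BilinearSchrodinger.diagCoeff μ j))) :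
    ∃ Tstar : ℝ, 0 < Tstar ∧ ∃ ε : ℝ, 0 < ε ∧
      ∀ T : ℝ, 0 < T → T < Tstar →
      ∀ u : ℝ → ℝ, MemLp u 2 (volume.restrict (Ioo 0 T)) →
        eLpNorm u 2 (volume.restrict (Ioo 0 T)) < ENNReal.ofReal ε →
      ∀ ψj ψk ψl : ℝ → BilinearSchrodinger.StateSpace,
        BilinearSchrodinger.IsWeakSolution T μ u (BilinearSchrodinger.eigenfunction j) ψj →
        BilinearSchrodinger.IsWeakSolution T μ u (BilinearSchrodinger.eigenfunction k) ψk →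
        BilinearSchrodinger.IsWeakSolution T μ u (BilinearSchrodinger.eigenfunction l) ψl →
      ∀ δ : ℝ, 0 < δ → ∀ ν : ℝ,
        (ψj T, ψk T, ψl T) ≠
          Complex.exp (Complex.I * ν) •
            (BilinearSchrodinger.eigenstate j T, BilinearSchrodinger.eigenstate k T,
              ((Real.sqrt (1 - δ ^ 2) : ℂ) + Complex.I * β * δ) •
                BilinearSchrodinger.eigenstate l T) := by
  obtain ⟨⟨hj, hk, hl⟩, hB0⟩ := BilinearSchrodinger.calB_ne_zero_of_perm hB hjkl
  obtain ⟨M, M₁, M₂, h₁, h₂, hc, hM, hM₁⟩ := hμ.exists_representative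
  have hsq : (fun x => BilinearSchrodinger.weakDeriv μ x ^ 2)
      =ᵐ[BilinearSchrodinger.vol01] fun x => M₁ x ^ 2 := by
    filter_upwards [hM₁] with x hx
    rw [hx]
  obtain ⟨Kj, pj, Hj⟩ := BilinearSchrodinger.exists_overlap_expansion h₁ h₂ hc hM hj
  obtain ⟨Kk, pk, Hk⟩ := BilinearSchrodinger.exists_overlap_expansion h₁ h₂ hc hM hk
  obtain ⟨Kl, pl, Hl⟩ := BilinearSchrodinger.exists_overlap_expansion h₁ h₂ hc hM hl
  simp only [← BilinearSchrodinger.diagCoeff_congr hM,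
    ← BilinearSchrodinger.diagCoeff_congr hsq] at Hj Hk Hl
  -- The sum of the three nonnegative constants serves as a common one for the three expansions.
  obtain ⟨η, hη, H⟩ := BilinearSchrodinger.exists_small_no_phase (K := Kj + Kk + Kl)
    (by positivity) hjk rfl hB0 hβ
  -- The bound 1 gives T ≤ 1 and |s| ≤ 1, as the expansions require; the bound `η` makes T, |s| and
  -- hence ∫ s² small, since s² ≤ |s| and T ≤ 1.
  refine ⟨min 1 η, by positivity, min 1 η, by positivity, ?_⟩
  intro T hT hTη u hu hun ψj ψk ψl hψj hψk hψl δ hδ ν heq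
  have hT1 : T ≤ 1 := hTη.le.trans (min_le_left _ _)
  obtain ⟨hui, hs⟩ := BilinearSchrodinger.abs_primitive_le_of_eLpNorm_lt hT.le hT1
    (by positivity) hu hun
  have hs1 : ∀ t ∈ Icc 0 T, |∫ τ in (0 : ℝ)..t, u τ| ≤ 1 := fun t ht =>
    (hs t ht).trans (min_le_left _ _)
  simp only [Prod.smul_mk, Prod.mk.injEq, smul_smul] at heq
  obtain ⟨eqj, eqk, eql⟩ := heq
  obtain ⟨Ej, aj, bj⟩ := Hj T hT u hui hs1 ψj _ hψj eqj
  obtain ⟨Ek, ak, bk⟩ := Hk T hT u hui hs1 ψk _ hψk eqk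
  obtain ⟨El, al, bl⟩ := Hl T hT u hui hs1 ψl _ hψl eql
  have hS0 : 0 ≤ ∫ t in (0 : ℝ)..T, (∫ τ in (0 : ℝ)..t, u τ) ^ 2 :=
    intervalIntegral.integral_nonneg hT.le fun t _ => sq_nonneg _
  have hSη : ∫ t in (0 : ℝ)..T, (∫ τ in (0 : ℝ)..t, u τ) ^ 2 ≤ η := by
    have hsC := BilinearSchrodinger.continuousOn_primitive hT.le hui
    have hb : ∀ t ∈ Icc 0 T, (∫ τ in (0 : ℝ)..t, u τ) ^ 2 ≤ η := fun t ht => by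
      rw [← sq_abs, sq]
      calc _ ≤ 1 * η := mul_le_mul (hs1 t ht) ((hs t ht).trans (min_le_right _ _))
            (abs_nonneg _) zero_le_one
        _ = η := one_mul η
    calc _ ≤ ∫ _ in (0 : ℝ)..T, η := by
          refine intervalIntegral.integral_mono_on hT.le ?_ (by simp) hb
          refine ContinuousOn.intervalIntegrable ?_
          rw [uIcc_of_le hT.le]
          exact hsC.pow 2
      _ = T * η := by simp
      _ ≤ 1 * η := by gcongr
      _ = η := one_mul η
  have hTS := mul_nonneg hT.le hS0
  refine H T _ _ hT.le (hTη.le.trans (min_le_right _ _))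
    ((hs T (right_mem_Icc.2 hT.le)).trans (min_le_right _ _)) hS0 hSη _ _ Ej Ek El
    (aj.trans ?_) (ak.trans ?_) (al.trans ?_) (bj.trans ?_) (bk.trans ?_) (bl.trans ?_) δ hδ ?_
  any_goals
    gcongr
    linarith
  -- Only the imaginary part βδ of the additional factor is used, so the value of the square root,
  -- in particular for δ > 1, plays no role.
  simp
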